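/- Let $K$ be a field with an embedding $K\hookrightarrow\mathbb{C}$ (for instance $K=\mathbb{R}$ or $K=\mathbb{C}$). **Rooted trees.** Let $H_R=K[\mathcal{T}]$ be the free commutative $K$-algebra on the set $\mathcal{T}$ of isomorphism classes of finite non-empty (unordered) rooted trees. Its monomials are the rooted forests, and $B_+\colon H_R\to H_R$ is the linear map that sends a forest to the tree obtained by connecting all its roots to a new root. $H_R$ is a Hopf algebra: its coproduct is the algebra morphism with $\Delta\circ B_+=B_+\otimes 1+(\mathrm{id}\otimes B_+)\circ\Delta$, its counit $\varepsilon$ vanishes on all non-empty forests, and $S$ is its antipode. $K[x]$ is the Hopf algebra with $\Delta(x)=x\otimes 1+1\otimes x$, $\varepsilon(x)=0$, $S(x)=-x$. **Toy model.** Let $f\colon(0,\infty)\to\mathbb{C}$ be a kernel such that $\zeta\mapsto f(\zeta)\zeta^{-\sigma}$ is integrable on $(0,\infty)$ for all sufficiently small $\sigma>0$, and such that $F(z)=\int_0^\infty f(\zeta)\,\zeta^{-z}\,d\zeta$ is given, for $z$ near $0$ with $\operatorname{Re}z>0$, by a convergent Laurent series $\sum_{n\ge-1}c_nz^n$ with all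 $c_n\in K$. The regularized Feynman rules are the algebra morphism $\phi$ from $H_R$ to functions of $z$ and of the scale $s>0$ with $$\phi_s(B_+(x))=\int_0^\infty f(\zeta)\,(s\zeta)^{-z}\,\phi_{s\zeta}(x)\,d\zeta\qquad\text{for all forests }x.$$ For $\mu>0$, the momentum scheme at the subtraction point $\mu$ (evaluation at $s=\mu$) gives the counterterm $Z=\phi_\mu\circ S$ and the renormalized Feynman rules $\phi_{R,s}=Z\star\phi_s$, where $\star$ is the convolution product $\alpha\star\beta=m\circ(\alpha\otimes\beta)\circ\Delta$. **Statement.** For every such $K$ and $f$: 1. For each $x\in H_R$, the integral $\int_0^\infty f(\zeta)(s\zeta)^{-z}\phi_{s\zeta}(x)\,d\zeta$ converges absolutely for all $s>0$ and all $z$ sufficiently close to $0$ with $\operatorname{Re}z>0$. 2. For all $x\in H_R$ and $s,\mu>0$, the function $z\mapsto\phi_{R,s}(x)$ continues meromorphically from $\operatorname{Re}z>0$ to a neighbourhood of $z=0$, and its limit at $z\to0$ (the physical limit) exists. There is a unique map $\phi_{\mathrm{phys}}\colon H_R\to K[x]$, the same for all $\mu$, such that this limit is always the value of the polynomial $\phi_{\mathrm{phys}}(x)$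 at $\ln\frac{s}{\mu}$. 3. This physical limit $\phi_{\mathrm{phys}}\colon H_R\to K[x]$ is a morphism of Hopf algebras: it is a morphism of unital algebras and of counital coalgebras, and it commutes with the antipodes. Moreover, the kernel $f(\zeta)=\frac{1}{1+\zeta}$ of the original toy model satisfies the assumptions above, with $K=\mathbb{R}$. -/

import Mathlib

open scoped TensorProduct Polynomial Topology

noncomputable section

namespace ToyModel

/-! ## Rooted trees -/

/-- Finite rooted trees with an enumeration of the children of every node. -/
inductive PlanarTree : Type
  | node (n : ℕ) (c : Fin n → PlanarTree) : PlanarTree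

namespace PlanarTree

/-- Isomorphism of rooted trees: a bijection between the children of the two roots such that
corresponding children carry isomorphic subtrees. -/
def Iso : PlanarTree → PlanarTree → Prop
  | node n c, node m d => ∃ e : Fin n ≃ Fin m, ∀ i, Iso (c i) (d (e i))

theorem Iso.refl : ∀ t : PlanarTree, Iso t t
  | node _ c => ⟨Equiv.refl _, fun i => Iso.refl (c i)⟩

theorem Iso.symm : ∀ {t u : PlanarTree}, Iso t u → Iso u t
  | node _ _, node _ d, ⟨e, h⟩ =>
    ⟨e.symm, fun i => by
      have h1 := (h (e.symm i)).symm
      rwa [e.apply_symm_apply] at h1⟩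

theorem Iso.trans : ∀ {t u v : PlanarTree}, Iso t u → Iso u v → Iso t v
  | node _ _, node _ _, node _ _, ⟨e, h⟩, ⟨e', h'⟩ =>
    ⟨e.trans e', fun i => (h i).trans (h' (e i))⟩

instance isoSetoid : Setoid PlanarTree := ⟨Iso, Iso.refl, Iso.symm, Iso.trans⟩

/-- Bottom-up recursion. -/
def fold {A : Type*} (g : Multiset A → A) : PlanarTree → A
  | node _ c => g (Finset.univ.val.map fun i => fold g (c i))

theorem fold_iso {A : Type*} (g : Multiset A → A) :
    ∀ {t u : PlanarTree}, Iso t u → fold g t = fold g u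
  | node n c, node m d, ⟨e, h⟩ => by
    have h1 : (fun i => fold g (c i)) = (fun j => fold g (d j)) ∘ e :=
      funext fun i => fold_iso g (h i)
    simp only [fold]
    rw [h1, ← Multiset.map_map]
    congr 2
    have h2 := congrArg Finset.val (Finset.map_univ_equiv e)
    rwa [Finset.map_val] at h2

end PlanarTree

/-- Rooted trees: isomorphism classes, so that the children of a node are unordered. -/
def RootedTree : Type := Quotient PlanarTree.isoSetoid

open Classical in
theorem exists_equiv_of_map_eq {α β γ : Type*} [Fintype α] [Fintype β] (f : α → γ) (g : β → γ)
    (h : Finset.univ.val.map f = Finset.univ.val.map g) : ∃ e : α ≃ β, ∀ i, f i = g (e i) := by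
  have key : ∀ c : γ, Fintype.card {i // f i = c} = Fintype.card {j // g j = c} := by
    intro c
    have h1 := congrArg (Multiset.count c) h
    rw [Multiset.count_map, Multiset.count_map] at h1
    rw [Fintype.card_subtype, Fintype.card_subtype]
    simpa [Finset.card, eq_comm] using h1
  let e : α ≃ β := (Equiv.sigmaFiberEquiv f).symm.trans
    ((Equiv.sigmaCongrRight fun c => Fintype.equivOfCardEq (key c)).trans
      (Equiv.sigmaFiberEquiv g))
  exact ⟨e, fun i => ((Fintype.equivOfCardEq (key (f i))) ⟨i, rfl⟩).2.symm⟩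

theorem map_toList_get {γ : Type*} (s : Multiset γ) :
    (Finset.univ : Finset (Fin s.toList.length)).val.map s.toList.get = s := by
  have h : (Finset.univ : Finset (Fin s.toList.length)).val =
      (List.finRange s.toList.length : Multiset (Fin s.toList.length)) := rfl
  rw [h, Multiset.map_coe, ← List.ofFn_eq_map, List.ofFn_get, Multiset.coe_toList]

namespace RootedTree

/-- The grafting of a forest (a multiset of rooted trees): all its roots become the children of
a new root. The auxiliary choices do not matter, see `graft_mk`. -/
def graft (s : Multiset RootedTree) : RootedTree :=
  Quotient.mk _ (PlanarTree.node s.toList.length fun i => (s.toList.get i).out)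

theorem graft_mk {n : ℕ} (c : Fin n → PlanarTree) :
    graft (Finset.univ.val.map fun i => (Quotient.mk _ (c i) : RootedTree)) =
      Quotient.mk _ (PlanarTree.node n c) := by
  obtain ⟨e, he⟩ := exists_equiv_of_map_eq _ _
    (map_toList_get (Finset.univ.val.map fun i => (Quotient.mk _ (c i) : RootedTree)))
  exact Quotient.sound ⟨e, fun i => Quotient.exact ((Quotient.out_eq _).trans (he i))⟩

/-- Bottom-up recursion on rooted trees; see `fold_graft`. -/
def fold {A : Type*} (g : Multiset A → A) (t : RootedTree) : A :=
  Quotient.liftOn t (PlanarTree.fold g) fun _ _ h => PlanarTree.fold_iso g h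

theorem fold_graft {A : Type*} (g : Multiset A → A) (s : Multiset RootedTree) :
    fold g (graft s) = g (s.map (fold g)) := by
  have h : ∀ t : RootedTree, PlanarTree.fold g t.out = fold g t := fun t => by
    conv_rhs => rw [← Quotient.out_eq t]
    rfl
  have h1 : fold g (graft s) =
      g ((Finset.univ : Finset (Fin s.toList.length)).val.map
        fun i => PlanarTree.fold g (s.toList.get i).out) := rfl
  rw [h1]
  simp only [h]
  conv_rhs => rw [← map_toList_get s, Multiset.map_map]
  rfl

theorem graft_induction {P : RootedTree → Prop}
    (h : ∀ s : Multiset RootedTree, (∀ t ∈ s, P t) → P (graft s)) (t : RootedTree) : P t := by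
  induction t using Quotient.ind with
  | _ p =>
    induction p with
    | node n c ih =>
      rw [← graft_mk]
      refine h _ fun t ht => ?_
      obtain ⟨i, -, rfl⟩ := Multiset.mem_map.1 ht
      exact ih i

end RootedTree

/-! ## The algebra of rooted trees, grafting and the universal property -/

/-- The free commutative algebra on the rooted trees; its monomials are the forests. -/
def HR (K : Type*) [CommRing K] : Type _ := MvPolynomial RootedTree K

section HR

variable (K : Type*) [CommRing K]

instance : CommRing (HR K) := inferInstanceAs (CommRing (MvPolynomial RootedTree K))
instance : Algebra K (HR K) := inferInstanceAs (Algebra K (MvPolynomial RootedTree K))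

/-- A rooted tree as an element of `HR K`. -/
def tree (t : RootedTree) : HR K := (MvPolynomial.X t : MvPolynomial RootedTree K)

/-- A forest as an element of `HR K`: the product of its trees. -/
def forest (s : Multiset RootedTree) : HR K := (s.map (tree K)).prod

/-- The basis of `HR K` consisting of the forests. -/
def forestBasis : Module.Basis (Multiset RootedTree) K (HR K) :=
  letI := Classical.decEq RootedTree
  (show Module.Basis (RootedTree →₀ ℕ) K (HR K) from
    MvPolynomial.basisMonomials RootedTree K).reindex Multiset.toFinsupp.symm.toEquiv

theorem forestBasis_apply (s : Multiset RootedTree) : forestBasis K s = forest K s := by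
  let := Classical.decEq RootedTree
  rw [forestBasis, Module.Basis.reindex_apply]
  change MvPolynomial.basisMonomials RootedTree K (Multiset.toFinsupp s) = _
  rw [MvPolynomial.coe_basisMonomials]
  change MvPolynomial.monomial (Multiset.toFinsupp s) (1 : K) = _
  rw [forest]
  induction s using Multiset.induction_on with
  | empty => simp; rfl
  | cons t s ih =>
    rw [Multiset.map_cons, Multiset.prod_cons, ← ih, ← Multiset.singleton_add, map_add,
      Multiset.toFinsupp_singleton]
    have h : MvPolynomial.monomial (Finsupp.single t 1 + Multiset.toFinsupp s) (1 : K) =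
        MvPolynomial.X t * MvPolynomial.monomial (Multiset.toFinsupp s) (1 : K) := by
      rw [MvPolynomial.X, MvPolynomial.monomial_mul, one_mul]
    exact h

/-- The grafting operator `B₊`. -/
def bPlus : HR K →ₗ[K] HR K :=
  (forestBasis K).constr K fun s => tree K (RootedTree.graft s)

theorem bPlus_forest (s : Multiset RootedTree) :
    bPlus K (forest K s) = tree K (RootedTree.graft s) := by
  rw [bPlus, ← forestBasis_apply, Module.Basis.constr_basis]

variable {K}

theorem algHom_ext_tree {A : Type*} [Semiring A] [Algebra K A] {f g : HR K →ₐ[K] A}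
    (h : ∀ t, f (tree K t) = g (tree K t)) : f = g :=
  MvPolynomial.algHom_ext h

theorem algHom_forest {A : Type*} [CommSemiring A] [Algebra K A] (f : HR K →ₐ[K] A)
    (s : Multiset RootedTree) : f (forest K s) = (s.map fun t => f (tree K t)).prod := by
  rw [forest, map_multiset_prod, Multiset.map_map]
  rfl

theorem linearMap_ext_forest {M : Type*} [AddCommMonoid M] [Module K M] {f g : HR K →ₗ[K] M}
    (h : ∀ s, f (forest K s) = g (forest K s)) : f = g :=
  (forestBasis K).ext fun s => by rw [forestBasis_apply, h]

theorem algHom_ext_bPlus {A : Type*} [CommSemiring A] [Algebra K A] {f g : HR K →ₐ[K] A}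
    (h : ∀ s, f (forest K s) = g (forest K s) →
      f (bPlus K (forest K s)) = g (bPlus K (forest K s))) : f = g := by
  refine algHom_ext_tree fun t => ?_
  induction t using RootedTree.graft_induction with
  | h s ih =>
    rw [← bPlus_forest]
    refine h s ?_
    rw [algHom_forest, algHom_forest]
    exact congrArg _ (Multiset.map_congr rfl ih)

variable (K)

/-- The algebra morphism `ρ` with `ρ (B₊ f) = L (ρ f)` for all forests `f`. -/
def universalHom {A : Type*} [CommSemiring A] [Algebra K A] (L : A → A) : HR K →ₐ[K] A :=
  (MvPolynomial.aeval (RootedTree.fold fun m => L m.prod) : MvPolynomial RootedTree K →ₐ[K] A)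

theorem universalHom_tree {A : Type*} [CommSemiring A] [Algebra K A] (L : A → A)
    (t : RootedTree) :
    universalHom K L (tree K t) = RootedTree.fold (fun m => L m.prod) t :=
  MvPolynomial.aeval_X _ t

theorem universalHom_bPlus_forest {A : Type*} [CommSemiring A] [Algebra K A] (L : A → A)
    (s : Multiset RootedTree) :
    universalHom K L (bPlus K (forest K s)) = L (universalHom K L (forest K s)) := by
  rw [bPlus_forest, universalHom_tree, RootedTree.fold_graft, algHom_forest]
  simp only [universalHom_tree]

theorem universalHom_bPlus {A : Type*} [CommSemiring A] [Algebra K A] (L : A →ₗ[K] A)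
    (x : HR K) : universalHom K L (bPlus K x) = L (universalHom K L x) := by
  have h : (universalHom K L).toLinearMap ∘ₗ bPlus K = L ∘ₗ (universalHom K L).toLinearMap :=
    linearMap_ext_forest fun s => universalHom_bPlus_forest K L s
  exact LinearMap.congr_fun h x

/-! ## The Hopf algebra structure of `HR K` -/

/-- The counit: `1` on the empty forest and `0` on all other forests. -/
def counitHR : HR K →ₐ[K] K := universalHom K (0 : K →ₗ[K] K)

theorem counitHR_bPlus (x : HR K) : counitHR K (bPlus K x) = 0 :=
  universalHom_bPlus K 0 x

/-- The operator on `HR K ⊗ HR K` that induces the coproduct; see `comulHR_bPlus`. -/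
def comulOp : HR K ⊗[K] HR K →ₗ[K] HR K ⊗[K] HR K :=
  (TensorProduct.mk K (HR K) (HR K)).flip 1 ∘ₗ bPlus K ∘ₗ
      (TensorProduct.rid K (HR K)).toLinearMap ∘ₗ (counitHR K).toLinearMap.lTensor (HR K)
    + (bPlus K).lTensor (HR K)

/-- The coproduct, determined by `comulHR_bPlus` as a morphism of algebras. -/
def comulHR : HR K →ₐ[K] HR K ⊗[K] HR K := universalHom K (comulOp K)

theorem rid_counit_comulHR (x : HR K) :
    TensorProduct.rid K (HR K) ((counitHR K).toLinearMap.lTensor (HR K) (comulHR K x)) = x := by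
  have h : ((Algebra.TensorProduct.rid K K (HR K)).toAlgHom.comp
      (Algebra.TensorProduct.map (AlgHom.id K (HR K)) (counitHR K))).comp (comulHR K) =
      AlgHom.id K (HR K) := by
    refine algHom_ext_bPlus fun s ih => ?_
    change TensorProduct.rid K (HR K)
      ((counitHR K).toLinearMap.lTensor (HR K) (comulHR K (forest K s))) = forest K s at ih
    change TensorProduct.rid K (HR K) ((counitHR K).toLinearMap.lTensor (HR K)
      (comulHR K (bPlus K (forest K s)))) = bPlus K (forest K s)
    have h1 : comulHR K (bPlus K (forest K s)) = comulOp K (comulHR K (forest K s)) :=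
      universalHom_bPlus K (comulOp K) _
    have h2 : (counitHR K).toLinearMap ∘ₗ bPlus K = 0 :=
      LinearMap.ext fun x => counitHR_bPlus K x
    rw [h1]
    simp only [comulOp, LinearMap.add_apply, LinearMap.comp_apply, LinearEquiv.coe_coe, ih,
      map_add, ← LinearMap.lTensor_comp_apply, h2, LinearMap.lTensor_zero, LinearMap.zero_apply,
      add_zero]
    simp
  exact DFunLike.congr_fun h x

theorem comulHR_bPlus (x : HR K) :
    comulHR K (bPlus K x) =
      bPlus K x ⊗ₜ[K] 1 + (bPlus K).lTensor (HR K) (comulHR K x) := by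
  have h := universalHom_bPlus K (comulOp K) x
  change comulHR K (bPlus K x) = comulOp K (comulHR K x) at h
  rw [h]
  simp only [comulOp, LinearMap.add_apply, LinearMap.comp_apply, LinearEquiv.coe_coe,
    rid_counit_comulHR]
  rfl

theorem assoc_comul_lTensor_bPlus (y : HR K ⊗[K] HR K) :
    TensorProduct.assoc K _ _ _
        ((comulHR K).toLinearMap.rTensor (HR K) ((bPlus K).lTensor (HR K) y)) =
      ((bPlus K).lTensor (HR K)).lTensor (HR K)
        (TensorProduct.assoc K _ _ _ ((comulHR K).toLinearMap.rTensor (HR K) y)) := by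
  induction y using TensorProduct.induction_on with
  | zero => simp
  | add a b ha hb => simp only [map_add, ha, hb]
  | tmul a b =>
    simp only [LinearMap.lTensor_tmul, LinearMap.rTensor_tmul]
    generalize (comulHR K).toLinearMap a = c
    induction c using TensorProduct.induction_on with
    | zero => simp
    | add c d hc hd => simp only [TensorProduct.add_tmul, map_add, hc, hd]
    | tmul c d => simp

theorem lTensor_comul_lTensor_bPlus (y : HR K ⊗[K] HR K) :
    (comulHR K).toLinearMap.lTensor (HR K) ((bPlus K).lTensor (HR K) y) =
      TensorProduct.assoc K _ _ _ ((bPlus K).lTensor (HR K) y ⊗ₜ[K] (1 : HR K)) +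
      ((bPlus K).lTensor (HR K)).lTensor (HR K)
        ((comulHR K).toLinearMap.lTensor (HR K) y) := by
  induction y using TensorProduct.induction_on with
  | zero => simp
  | add a b ha hb =>
    simp only [map_add, ha, hb, TensorProduct.add_tmul]
    abel
  | tmul a b =>
    simp only [LinearMap.lTensor_tmul, AlgHom.toLinearMap_apply, comulHR_bPlus,
      TensorProduct.tmul_add, TensorProduct.assoc_tmul]

instance : Bialgebra K (HR K) :=
  .ofAlgHom (comulHR K) (counitHR K)
    (by
      refine algHom_ext_bPlus fun s ih => ?_
      change TensorProduct.assoc K _ _ _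
        ((comulHR K).toLinearMap.rTensor (HR K) (comulHR K (forest K s))) =
        (comulHR K).toLinearMap.lTensor (HR K) (comulHR K (forest K s)) at ih
      change TensorProduct.assoc K _ _ _
        ((comulHR K).toLinearMap.rTensor (HR K) (comulHR K (bPlus K (forest K s)))) =
        (comulHR K).toLinearMap.lTensor (HR K) (comulHR K (bPlus K (forest K s)))
      rw [comulHR_bPlus, map_add, map_add, map_add, assoc_comul_lTensor_bPlus, ih,
        lTensor_comul_lTensor_bPlus, LinearMap.rTensor_tmul, LinearMap.lTensor_tmul,
        AlgHom.toLinearMap_apply, AlgHom.toLinearMap_apply, comulHR_bPlus, map_one,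
        TensorProduct.add_tmul, map_add, Algebra.TensorProduct.one_def,
        TensorProduct.assoc_tmul, add_assoc])
    (by
      refine algHom_ext_bPlus fun s ih => ?_
      change (counitHR K).toLinearMap.rTensor (HR K) (comulHR K (forest K s)) =
        1 ⊗ₜ[K] forest K s at ih
      change (counitHR K).toLinearMap.rTensor (HR K) (comulHR K (bPlus K (forest K s))) =
        1 ⊗ₜ[K] bPlus K (forest K s)
      have h (y : HR K ⊗[K] HR K) :
          (counitHR K).toLinearMap.rTensor (HR K) ((bPlus K).lTensor (HR K) y) =
          (bPlus K).lTensor K ((counitHR K).toLinearMap.rTensor (HR K) y) := by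
        rw [← LinearMap.comp_apply, ← LinearMap.comp_apply, LinearMap.rTensor_comp_lTensor,
          LinearMap.lTensor_comp_rTensor]
      rw [comulHR_bPlus, map_add, h, ih, LinearMap.rTensor_tmul, AlgHom.toLinearMap_apply,
        counitHR_bPlus, TensorProduct.zero_tmul, zero_add, LinearMap.lTensor_tmul])
    (by
      refine AlgHom.ext fun x => ?_
      refine (TensorProduct.rid K (HR K)).injective ?_
      change TensorProduct.rid K (HR K)
        ((counitHR K).toLinearMap.lTensor (HR K) (comulHR K x)) =
        TensorProduct.rid K (HR K) (x ⊗ₜ[K] (1 : K))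
      rw [rid_counit_comulHR, TensorProduct.rid_tmul, one_smul])

/-- The operator on `HR K ⊗ HR K` whose induced morphism is `(S ⊗ id) ∘ Δ` with the
antipode `S`. -/
def antipodeOp : HR K ⊗[K] HR K →ₗ[K] HR K ⊗[K] HR K :=
  (bPlus K).lTensor (HR K) -
    (TensorProduct.mk K (HR K) (HR K)).flip 1 ∘ₗ LinearMap.mul' K (HR K) ∘ₗ
      (bPlus K).lTensor (HR K)

/-- The antipode; it is characterized by the instance `HopfAlgebra K (HR K)` below. -/
def antipodeHR : HR K →ₐ[K] HR K :=
  ((Algebra.TensorProduct.rid K K (HR K)).toAlgHom.comp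
    (Algebra.TensorProduct.map (AlgHom.id K (HR K)) (counitHR K))).comp
      (universalHom K (antipodeOp K))

theorem antipodeHR_bPlus (x : HR K) :
    antipodeHR K (bPlus K x) =
      -LinearMap.mul' K (HR K)
        ((bPlus K).lTensor (HR K) (universalHom K (antipodeOp K) x)) := by
  have h2 : (counitHR K).toLinearMap ∘ₗ bPlus K = 0 :=
    LinearMap.ext fun x => counitHR_bPlus K x
  change TensorProduct.rid K (HR K) ((counitHR K).toLinearMap.lTensor (HR K)
    (universalHom K (antipodeOp K) (bPlus K x))) = _
  rw [universalHom_bPlus]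
  simp only [antipodeOp, LinearMap.sub_apply, LinearMap.comp_apply, map_sub,
    ← LinearMap.lTensor_comp_apply, h2, LinearMap.lTensor_zero, LinearMap.zero_apply,
    zero_sub]
  simp

theorem rTensor_antipodeHR_comul (x : HR K) :
    (antipodeHR K).toLinearMap.rTensor (HR K) (comulHR K x) =
      universalHom K (antipodeOp K) x := by
  have h : (Algebra.TensorProduct.map (antipodeHR K) (AlgHom.id K (HR K))).comp (comulHR K) =
      universalHom K (antipodeOp K) := by
    refine algHom_ext_bPlus fun s ih => ?_
    change (antipodeHR K).toLinearMap.rTensor (HR K) (comulHR K (forest K s)) = _ at ih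
    change (antipodeHR K).toLinearMap.rTensor (HR K) (comulHR K (bPlus K (forest K s))) = _
    have h1 (y : HR K ⊗[K] HR K) :
        (antipodeHR K).toLinearMap.rTensor (HR K) ((bPlus K).lTensor (HR K) y) =
        (bPlus K).lTensor (HR K) ((antipodeHR K).toLinearMap.rTensor (HR K) y) := by
      rw [← LinearMap.comp_apply, ← LinearMap.comp_apply, LinearMap.rTensor_comp_lTensor,
        LinearMap.lTensor_comp_rTensor]
    rw [comulHR_bPlus, map_add, h1, ih, LinearMap.rTensor_tmul, AlgHom.toLinearMap_apply,
      antipodeHR_bPlus, universalHom_bPlus]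
    simp only [antipodeOp, LinearMap.sub_apply, LinearMap.comp_apply, LinearMap.flip_apply,
      TensorProduct.mk_apply, TensorProduct.neg_tmul]
    abel
  exact DFunLike.congr_fun h x

theorem mul_antipodeOp (x : HR K) :
    LinearMap.mul' K (HR K) (universalHom K (antipodeOp K) x) =
      algebraMap K (HR K) (counitHR K x) := by
  have h : (Algebra.TensorProduct.lmul' K (S := HR K)).comp (universalHom K (antipodeOp K)) =
      (Algebra.ofId K (HR K)).comp (counitHR K) := by
    refine algHom_ext_bPlus fun s _ => ?_
    change LinearMap.mul' K (HR K) (universalHom K (antipodeOp K) (bPlus K (forest K s))) =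
      algebraMap K (HR K) (counitHR K (bPlus K (forest K s)))
    rw [universalHom_bPlus, counitHR_bPlus, map_zero]
    simp [antipodeOp]
  exact DFunLike.congr_fun h x

/-- The convolution product `id ⋆ S`. -/
def idConvAntipode : HR K →ₐ[K] HR K :=
  (Algebra.TensorProduct.lift (AlgHom.id K (HR K)) (antipodeHR K)
    fun _ _ => Commute.all _ _).comp (comulHR K)

theorem lift_lTensor_bPlus (y : HR K ⊗[K] HR K) :
    Algebra.TensorProduct.lift (AlgHom.id K (HR K)) (antipodeHR K) (fun _ _ => Commute.all _ _)
        ((bPlus K).lTensor (HR K) y) =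
      -LinearMap.mul' K (HR K) ((LinearMap.mul' K (HR K) ∘ₗ
        TensorProduct.map (antipodeHR K).toLinearMap (bPlus K)).lTensor (HR K)
        ((comulHR K).toLinearMap.lTensor (HR K) y)) := by
  induction y using TensorProduct.induction_on with
  | zero => simp
  | add a b ha hb =>
    simp only [map_add, ha, hb]
    abel
  | tmul a b =>
    have h : TensorProduct.map (antipodeHR K).toLinearMap (bPlus K) (comulHR K b) =
        (bPlus K).lTensor (HR K) (universalHom K (antipodeOp K) b) := by
      rw [← rTensor_antipodeHR_comul, ← LinearMap.comp_apply, LinearMap.lTensor_comp_rTensor]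
    simp only [LinearMap.lTensor_tmul, Algebra.TensorProduct.lift_tmul, AlgHom.id_apply,
      antipodeHR_bPlus, LinearMap.comp_apply, AlgHom.toLinearMap_apply, h,
      LinearMap.mul'_apply, mul_neg]

theorem mul_lTensor_assoc (y : HR K ⊗[K] HR K) :
    LinearMap.mul' K (HR K) ((LinearMap.mul' K (HR K) ∘ₗ
        TensorProduct.map (antipodeHR K).toLinearMap (bPlus K)).lTensor (HR K)
        (TensorProduct.assoc K _ _ _ ((comulHR K).toLinearMap.rTensor (HR K) y))) =
      LinearMap.mul' K (HR K) ((bPlus K).lTensor (HR K)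
        ((idConvAntipode K).toLinearMap.rTensor (HR K) y)) := by
  induction y using TensorProduct.induction_on with
  | zero => simp
  | add a b ha hb => simp only [map_add, ha, hb]
  | tmul a b =>
    simp only [LinearMap.rTensor_tmul, AlgHom.toLinearMap_apply, LinearMap.lTensor_tmul,
      idConvAntipode, AlgHom.comp_apply, LinearMap.mul'_apply]
    generalize comulHR K a = c
    induction c using TensorProduct.induction_on with
    | zero => simp
    | add c d hc hd => simp only [TensorProduct.add_tmul, map_add, hc, hd, add_mul]
    | tmul c d => simp [mul_assoc]

theorem idConvAntipode_apply (x : HR K) :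
    idConvAntipode K x = algebraMap K (HR K) (counitHR K x) := by
  have h : (Algebra.TensorProduct.map (idConvAntipode K) (AlgHom.id K (HR K))).comp
      (comulHR K) = Algebra.TensorProduct.includeRight := by
    refine algHom_ext_bPlus fun s ih => ?_
    change (idConvAntipode K).toLinearMap.rTensor (HR K) (comulHR K (forest K s)) =
      1 ⊗ₜ[K] forest K s at ih
    change (idConvAntipode K).toLinearMap.rTensor (HR K) (comulHR K (bPlus K (forest K s))) =
      1 ⊗ₜ[K] bPlus K (forest K s)
    have h1 (y : HR K ⊗[K] HR K) :
        (idConvAntipode K).toLinearMap.rTensor (HR K) ((bPlus K).lTensor (HR K) y) =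
        (bPlus K).lTensor (HR K) ((idConvAntipode K).toLinearMap.rTensor (HR K) y) := by
      rw [← LinearMap.comp_apply, ← LinearMap.comp_apply, LinearMap.rTensor_comp_lTensor,
        LinearMap.lTensor_comp_rTensor]
    have h2 : (comulHR K).toLinearMap.lTensor (HR K) (comulHR K (forest K s)) =
        TensorProduct.assoc K _ _ _
          ((comulHR K).toLinearMap.rTensor (HR K) (comulHR K (forest K s))) :=
      (Coalgebra.coassoc_apply (R := K) (forest K s)).symm
    have h3 : idConvAntipode K (bPlus K (forest K s)) = 0 := by
      rw [idConvAntipode, AlgHom.comp_apply, comulHR_bPlus, map_add, lift_lTensor_bPlus, h2,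
        mul_lTensor_assoc, ih]
      simp
    rw [comulHR_bPlus, map_add, h1, ih, LinearMap.rTensor_tmul, AlgHom.toLinearMap_apply, h3,
      TensorProduct.zero_tmul, zero_add, LinearMap.lTensor_tmul]
  have h1 : (idConvAntipode K).toLinearMap.rTensor (HR K) (comulHR K x) = 1 ⊗ₜ[K] x :=
    DFunLike.congr_fun h x
  have h2 (y : HR K ⊗[K] HR K) :
      TensorProduct.rid K (HR K) ((counitHR K).toLinearMap.lTensor (HR K)
        ((idConvAntipode K).toLinearMap.rTensor (HR K) y)) =
      idConvAntipode K (TensorProduct.rid K (HR K)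
        ((counitHR K).toLinearMap.lTensor (HR K) y)) := by
    induction y using TensorProduct.induction_on with
    | zero => simp
    | add a b ha hb => simp only [map_add, ha, hb]
    | tmul a b => simp
  rw [← rid_counit_comulHR K x, ← h2, h1, rid_counit_comulHR, LinearMap.lTensor_tmul,
    TensorProduct.rid_tmul, Algebra.algebraMap_eq_smul_one]
  rfl

instance : HopfAlgebra K (HR K) :=
  .ofAlgHom (antipodeHR K)
    (by
      refine AlgHom.ext fun x => ?_
      have h (y : HR K ⊗[K] HR K) :
          Algebra.TensorProduct.lift (antipodeHR K) (AlgHom.id K (HR K))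
            (fun _ => Commute.all _) y =
          LinearMap.mul' K (HR K) ((antipodeHR K).toLinearMap.rTensor (HR K) y) := by
        induction y using TensorProduct.induction_on with
        | zero => simp
        | add a b ha hb => simp only [map_add, ha, hb]
        | tmul a b => exact Algebra.TensorProduct.lift_tmul _ _ _ _ _
      exact (h (comulHR K x)).trans ((congrArg _ (rTensor_antipodeHR_comul K x)).trans
        (mul_antipodeOp K x)))
    (AlgHom.ext fun x => idConvAntipode_apply K x)

end HR

/-! ## The Hopf algebra of polynomials in one variable -/

section Polynomials

variable (K : Type*) [CommRing K]

/-- The bialgebra `K[x]` in which `x` is primitive. -/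
instance : Bialgebra K K[X] :=
  .ofAlgHom
    (Polynomial.aeval (Polynomial.X ⊗ₜ[K] 1 + 1 ⊗ₜ[K] Polynomial.X))
    (Polynomial.aeval 0)
    (by
      ext
      simp [Algebra.TensorProduct.one_def, TensorProduct.add_tmul, TensorProduct.tmul_add,
        add_assoc])
    (by ext; simp)
    (by ext; simp)

theorem comul_X : Coalgebra.comul (R := K) (Polynomial.X : K[X]) =
    Polynomial.X ⊗ₜ[K] 1 + 1 ⊗ₜ[K] Polynomial.X :=
  Polynomial.aeval_X _

theorem counit_X : Coalgebra.counit (R := K) (Polynomial.X : K[X]) = 0 :=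
  Polynomial.aeval_X _

instance : HopfAlgebra K K[X] :=
  .ofAlgHom (Polynomial.aeval (-Polynomial.X))
    (by
      refine Polynomial.algHom_ext ?_
      simp only [AlgHom.comp_apply, Bialgebra.comulAlgHom_apply, comul_X, map_add,
        Bialgebra.counitAlgHom_apply, counit_X, map_zero]
      refine (congrArg₂ (· + ·) (Algebra.TensorProduct.lift_tmul _ _ _ _ _)
        (Algebra.TensorProduct.lift_tmul _ _ _ _ _)).trans ?_
      simp)
    (by
      refine Polynomial.algHom_ext ?_
      simp only [AlgHom.comp_apply, Bialgebra.comulAlgHom_apply, comul_X, map_add,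
        Bialgebra.counitAlgHom_apply, counit_X, map_zero]
      refine (congrArg₂ (· + ·) (Algebra.TensorProduct.lift_tmul _ _ _ _ _)
        (Algebra.TensorProduct.lift_tmul _ _ _ _ _)).trans ?_
      simp)

end Polynomials

/-! ## The toy model -/

section Toy

variable (K : Type*) [Field K] [Algebra K ℂ]

/-- The integral operator of the toy model with kernel `f` on functions `g` of the regulator `z`
and the scale `s`: `(L g)(z, s) = ∫₀^∞ f(ζ) (s ζ)^(-z) g(z, s ζ) dζ`. -/
def toyOp (f : ℝ → ℂ) (g : ℂ → ℝ → ℂ) : ℂ → ℝ → ℂ := fun z s =>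
  ∫ ζ in Set.Ioi (0 : ℝ), f ζ * ((s * ζ : ℝ) : ℂ) ^ (-z) * g z (s * ζ)

/-- The regularized Feynman rules: the algebra morphism `φ` with `φ ∘ B₊ = L ∘ φ` on forests. -/
def toyRule (f : ℝ → ℂ) : HR K →ₐ[K] (ℂ → ℝ → ℂ) := universalHom K (toyOp f)

theorem toyRule_bPlus_forest (f : ℝ → ℂ) (x : Multiset RootedTree) (z : ℂ) (s : ℝ) :
    toyRule K f (bPlus K (forest K x)) z s =
      ∫ ζ in Set.Ioi (0 : ℝ),
        f ζ * ((s * ζ : ℝ) : ℂ) ^ (-z) * toyRule K f (forest K x) z (s * ζ) :=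
  congrFun (congrFun (universalHom_bPlus_forest K (toyOp f) x) z) s

/-- The momentum scheme: evaluation at the scale `s = μ`. -/
def momentumScheme (μ : ℝ) : (ℂ → ℝ → ℂ) →ₐ[K] (ℂ → ℝ → ℂ) where
  toFun g := fun z _ => g z μ
  map_one' := rfl
  map_mul' _ _ := rfl
  map_zero' := rfl
  map_add' _ _ := rfl
  commutes' _ := rfl

/-- The counterterm `R ∘ φ ∘ S` for the momentum scheme `R`. -/
def toyCounterterm (f : ℝ → ℂ) (μ : ℝ) : HR K →ₐ[K] (ℂ → ℝ → ℂ) :=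
  (momentumScheme K μ).comp ((toyRule K f).comp (HopfAlgebra.antipodeAlgHom K (HR K)))

/-- The renormalized Feynman rules: the convolution product of the counterterm with the
regularized Feynman rules. -/
def toyRenormalized (f : ℝ → ℂ) (μ : ℝ) : HR K →ₐ[K] (ℂ → ℝ → ℂ) :=
  (WithConv.toConv (toyCounterterm K f μ) * WithConv.toConv (toyRule K f)).ofConv

/-- The Birkhoff conditions for the splitting into the image and the kernel of the momentum
scheme: the counterterm takes values in the image and, on the augmentation ideal, the
renormalized rules take values in the kernel. -/
theorem birkhoff (f : ℝ → ℂ) (μ : ℝ) :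
    (∀ x, momentumScheme K μ (toyCounterterm K f μ x) = toyCounterterm K f μ x) ∧
      ∀ x, Coalgebra.counit (R := K) x = 0 →
        momentumScheme K μ (toyRenormalized K f μ x) = 0 := by
  refine ⟨fun _ => rfl, fun x hx => ?_⟩
  have h : (momentumScheme K μ).comp (toyRenormalized K f μ) =
      ((momentumScheme K μ).comp (toyRule K f)).comp
        (WithConv.toConv (HopfAlgebra.antipodeAlgHom K (HR K)) *
          WithConv.toConv (AlgHom.id K (HR K))).ofConv := by
    rw [toyRenormalized, AlgHom.comp_convMul_distrib, AlgHom.comp_convMul_distrib]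
    rfl
  rw [AlgHom.antipode_id_cancel] at h
  have h2 : momentumScheme K μ (toyRenormalized K f μ x) =
      momentumScheme K μ (toyRule K f (algebraMap K (HR K) (Coalgebra.counit x))) :=
    DFunLike.congr_fun h x
  rw [h2, hx, map_zero, map_zero, map_zero]

/-- The kernels `f` that are admitted for the toy model: `ζ ↦ f(ζ) ζ^(-σ)` is absolutely
integrable on `(0, ∞)` for all sufficiently small `σ > 0`, and
`F(z) = ∫₀^∞ f(ζ) ζ^(-z) dζ` has at `z = 0` a Laurent expansion `∑_{n ≥ -1} c_n z^n` with
coefficients in `K`, here `c_n = c (n + 1)`. -/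
def IsToyKernel (f : ℝ → ℂ) : Prop :=
  (∀ᶠ σ : ℝ in 𝓝[>] 0,
      MeasureTheory.IntegrableOn (fun ζ : ℝ => f ζ * (ζ : ℂ) ^ (-(σ : ℂ))) (Set.Ioi 0)) ∧
    ∃ c : ℕ → K, ∀ᶠ z : ℂ in 𝓝[{z | 0 < z.re}] 0,
      HasSum (fun n : ℕ => algebraMap K ℂ (c n) * z ^ ((n : ℤ) - 1))
        (∫ ζ in Set.Ioi (0 : ℝ), f ζ * (ζ : ℂ) ^ (-z))

/-- The limit at `z = 0` of a function given near `0` in the half-plane `Re z > 0`: that of its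
meromorphic continuation to a neighbourhood of `0`. -/
def HasPhysicalLimit (g : ℂ → ℂ) (v : ℂ) : Prop :=
  ∃ G : ℂ → ℂ, MeromorphicAt G 0 ∧ (∀ᶠ z in 𝓝[{z | 0 < z.re}] 0, g z = G z) ∧
    Filter.Tendsto G (𝓝[≠] 0) (𝓝 v)

/-- `Ψ` is the physical limit of the renormalized Feynman rules with subtraction point `μ`:
for every `x` and every scale `s > 0`, the polynomial `Ψ x` takes at `ln (s / μ)` the limit at
`z = 0` of the renormalized value of `x` as its value. -/
def IsPhysicalLimit (f : ℝ → ℂ) (μ : ℝ) (Ψ : HR K → K[X]) : Prop :=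
  ∀ (x : HR K) (s : ℝ), 0 < s →
    HasPhysicalLimit (fun z => toyRenormalized K f μ x z s)
      (Polynomial.aeval ((Real.log (s / μ) : ℝ) : ℂ) (Ψ x))

end Toy

end ToyModel

/-! With `ℓ = ln (s/μ)` and `X = e^(-zℓ)`, the regularized Feynman rules become polynomials in `X`
with meromorphic coefficients. Since `(s/μ)^(-z)` is only rescaled by `s ↦ sζ`, the integral
operator of the toy model multiplies the coefficient of `X^k` by the Mellin transform `F (kz)` of
the kernel; in other words, it is `F (-d/dℓ)` composed with the multiplication by `μ^(-z) X`.
Write `F (w) = H (w) / w` with `H` analytic at `0`. The momentum scheme subtracts the value at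
`ℓ = 0`, which turns `F (-d/dℓ)` into `-∫₀^ℓ H (-d/dℓ)`: the pole is gone. At `z = 0` the
renormalized Feynman rules thus send `B₊` to the operator `-∫₀ H (-d/dx)` on polynomials, which is
a Hochschild cocycle of `K[x]`, and by the universal property of rooted trees a cocycle induces a
morphism of Hopf algebras.

For the kernel `1 / (1 + ζ)`, the substitution `ζ ↦ 1/ζ` on `(1, ∞)` exhibits the pole of `F`; the
remaining integrals over `(0, 1]` are expanded under the integral sign. -/

namespace ToyModel

section HopfAlgebras

open WithConv

variable {K : Type*} [CommRing K]

theorem bialgHom_antipode {A B : Type*} [CommSemiring A] [HopfAlgebra K A] [CommSemiring B]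
    [HopfAlgebra K B] (Φ : A →ₐc[K] B) (x : A) :
    Φ (HopfAlgebra.antipode K x) = HopfAlgebra.antipode K (Φ x) := by
  have h_comp : toConv ((HopfAlgebra.antipodeAlgHom K B).comp (Φ : A →ₐ[K] B)) *
      toConv (Φ : A →ₐ[K] B) = 1 := by
    refine ofConv_injective ((AlgHom.convMul_comp_bialgHom_distrib
      (toConv (HopfAlgebra.antipodeAlgHom K B)) (toConv (AlgHom.id K B)) Φ).symm.trans ?_)
    rw [AlgHom.antipode_id_cancel]
    refine AlgHom.ext fun y => ?_
    exact congrArg (algebraMap K B) (CoalgHomClass.counit_comp_apply Φ y)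
  exact (DFunLike.congr_fun (congrArg ofConv (eq_inv_of_mul_eq_one_left h_comp)) x).symm

/-- The Hochschild one-cocycles of a bialgebra `B`, with the trivial coaction on one side:
`Δ ∘ L = L ⊗ 1 + (id ⊗ L) ∘ Δ`. They are the operators to which `B₊` can be mapped by morphisms of
bialgebras. -/
def IsHochschildCocycle {B : Type*} [Semiring B] [Bialgebra K B] (L : B →ₗ[K] B) : Prop :=
  ∀ b, Coalgebra.comul (R := K) (L b) =
    L b ⊗ₜ[K] 1 + L.lTensor B (Coalgebra.comul (R := K) b)

namespace IsHochschildCocycle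

section Semiring

variable {B : Type*} [Semiring B] [Bialgebra K B] {L : B →ₗ[K] B}

theorem counit_apply (hL : IsHochschildCocycle L) (b : B) :
    Coalgebra.counit (R := K) (L b) = 0 := by
  have h_counit (y : B ⊗[K] B) : TensorProduct.rid K K (TensorProduct.map Coalgebra.counit
      Coalgebra.counit (L.lTensor B y)) = Coalgebra.counit (R := K) (L (TensorProduct.lid K B
        (Coalgebra.counit.rTensor B y))) := by
    induction y using TensorProduct.induction_on with
    | zero => simp
    | add y₁ y₂ h₁ h₂ => simp only [map_add, h₁, h₂]
    | tmul b₁ b₂ => simp [mul_comm]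
  have h_comul (c : B) : TensorProduct.rid K K (TensorProduct.map Coalgebra.counit
      Coalgebra.counit (Coalgebra.comul (R := K) c)) = Coalgebra.counit (R := K) c := by
    rw [← LinearMap.rTensor_comp_lTensor, LinearMap.comp_apply, Coalgebra.lTensor_counit_comul]
    simp
  have h := congrArg (fun y => TensorProduct.rid K K
    (TensorProduct.map Coalgebra.counit Coalgebra.counit y)) (hL b)
  simp only [map_add, h_counit, h_comul, Coalgebra.rTensor_counit_comul] at h
  simpa using h

theorem comp (hL : IsHochschildCocycle L) {T : B →ₗ[K] B}
    (hT : ∀ b, Coalgebra.comul (R := K) (T b) = T.lTensor B (Coalgebra.comul (R := K) b)) :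
    IsHochschildCocycle (L ∘ₗ T) := fun b => by
  rw [LinearMap.comp_apply, hL, hT, LinearMap.lTensor_comp_apply]

end Semiring

theorem neg {B : Type*} [Ring B] [Bialgebra K B] {L : B →ₗ[K] B} (hL : IsHochschildCocycle L) :
    IsHochschildCocycle (-L) := fun b => by
  simp only [LinearMap.neg_apply, map_neg, hL b, TensorProduct.neg_tmul, LinearMap.lTensor_neg]
  abel

variable {B : Type*} [CommSemiring B] [Bialgebra K B] {L : B →ₗ[K] B}

theorem comulAlgHom_comp_universalHom (hL : IsHochschildCocycle L) :
    (Algebra.TensorProduct.map (universalHom K L) (universalHom K L)).comp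
        (Bialgebra.comulAlgHom K (HR K)) =
      (Bialgebra.comulAlgHom K B).comp (universalHom K L) := by
  set ρ := universalHom K L
  have h_lTensor (y : HR K ⊗[K] HR K) :
      Algebra.TensorProduct.map ρ ρ ((bPlus K).lTensor (HR K) y) =
        L.lTensor B (Algebra.TensorProduct.map ρ ρ y) := by
    induction y using TensorProduct.induction_on with
    | zero => simp
    | add a b ha hb => simp only [map_add, ha, hb]
    | tmul a b => simp [ρ, universalHom_bPlus]
  refine algHom_ext_bPlus fun s ih => ?_
  change Algebra.TensorProduct.map ρ ρ (comulHR K (forest K s)) =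
    Coalgebra.comul (R := K) (ρ (forest K s)) at ih
  change Algebra.TensorProduct.map ρ ρ (comulHR K (bPlus K (forest K s))) =
    Coalgebra.comul (R := K) (ρ (bPlus K (forest K s)))
  rw [comulHR_bPlus, universalHom_bPlus, hL, map_add, h_lTensor, ih,
    Algebra.TensorProduct.map_tmul, universalHom_bPlus, map_one]

theorem counitAlgHom_comp_universalHom (hL : IsHochschildCocycle L) :
    (Bialgebra.counitAlgHom K B).comp (universalHom K L) = Bialgebra.counitAlgHom K (HR K) := by
  refine algHom_ext_bPlus fun s _ => ?_
  change Coalgebra.counit (R := K) (universalHom K L (bPlus K (forest K s))) =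
    counitHR K (bPlus K (forest K s))
  rw [universalHom_bPlus, hL.counit_apply, counitHR_bPlus]

/-- The morphism of bialgebras `ρ` with `ρ ∘ B₊ = L ∘ ρ`, for a cocycle `L`. -/
def universalBialgHom (hL : IsHochschildCocycle L) : HR K →ₐc[K] B :=
  .ofAlgHom (universalHom K L) hL.counitAlgHom_comp_universalHom hL.comulAlgHom_comp_universalHom

end IsHochschildCocycle

/-- The renormalization `(R ∘ φ ∘ S) ⋆ φ` of a character `φ` with respect to a multiplicative
projection `R`. -/
def renormalize {H A : Type*} [CommSemiring H] [HopfAlgebra K H] [CommSemiring A] [Algebra K A]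
    (R : A →ₐ[K] A) (φ : H →ₐ[K] A) : H →ₐ[K] A :=
  (toConv ((R.comp φ).comp (HopfAlgebra.antipodeAlgHom K H)) * toConv φ).ofConv

section Renormalize

variable {H A B C : Type*} [CommSemiring H] [HopfAlgebra K H] [CommSemiring A] [Algebra K A]
  [CommSemiring B] [Algebra K B] [CommSemiring C] [Algebra K C]

theorem comp_renormalize (R : A →ₐ[K] A) (φ : H →ₐ[K] A) (θ : A →ₐ[K] C) :
    θ.comp (renormalize R φ) =
      (toConv ((θ.comp (R.comp φ)).comp (HopfAlgebra.antipodeAlgHom K H)) *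
        toConv (θ.comp φ)).ofConv :=
  AlgHom.comp_convMul_distrib _ _ _

theorem comp_renormalize_congr {R : A →ₐ[K] A} {φ : H →ₐ[K] A} {R' : B →ₐ[K] B} {φ' : H →ₐ[K] B}
    {θ : A →ₐ[K] C} {θ' : B →ₐ[K] C} (hφ : θ.comp φ = θ'.comp φ')
    (hR : θ.comp (R.comp φ) = θ'.comp (R'.comp φ')) :
    θ.comp (renormalize R φ) = θ'.comp (renormalize R' φ') := by
  rw [comp_renormalize, comp_renormalize, hφ, hR]

theorem projection_renormalize {R : A →ₐ[K] A} (hR : ∀ a, R (R a) = R a) (φ : H →ₐ[K] A) (x : H) :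
    R (renormalize R φ x) = algebraMap K A (Coalgebra.counit x) := by
  have h_idem : R.comp (R.comp φ) = R.comp φ := AlgHom.ext fun y => hR (φ y)
  have h_cancel : R.comp (renormalize R φ) = (R.comp φ).comp
      (toConv (HopfAlgebra.antipodeAlgHom K H) * toConv (AlgHom.id K H)).ofConv := by
    rw [comp_renormalize, h_idem, AlgHom.comp_convMul_distrib]
    rfl
  rw [AlgHom.antipode_id_cancel] at h_cancel
  exact (DFunLike.congr_fun h_cancel x).trans ((R.comp φ).commutes _)

end Renormalize

theorem convMul_bPlus {A : Type*} [CommSemiring A] [Algebra K A] {φ ψ : HR K →ₐ[K] A}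
    {L : A →ₗ[K] A} (hφ : ∀ x, φ (bPlus K x) = L (φ x))
    (hL : ∀ x a, L (ψ x * a) = ψ x * L a) (x : HR K) :
    (toConv ψ * toConv φ) (bPlus K x) = ψ (bPlus K x) + L ((toConv ψ * toConv φ) x) := by
  set m := Algebra.TensorProduct.lift ψ φ fun _ _ => Commute.all _ _
  have h_apply (x : HR K) : (toConv ψ * toConv φ) x = m (comulHR K x) :=
    AlgHom.convMul_apply (toConv ψ) (toConv φ) x
  have h_lTensor (y : HR K ⊗[K] HR K) : m ((bPlus K).lTensor (HR K) y) = L (m y) := by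
    induction y using TensorProduct.induction_on with
    | zero => simp
    | add a b ha hb => simp only [map_add, ha, hb]
    | tmul a b => simp [m, hφ, hL]
  rw [h_apply, h_apply, comulHR_bPlus, map_add, h_lTensor]
  simp [m]

theorem renormalize_bPlus {A : Type*} [CommRing A] [Algebra K A] {R : A →ₐ[K] A}
    {φ : HR K →ₐ[K] A} {L : A →ₗ[K] A} (hR : ∀ a, R (R a) = R a)
    (hφ : ∀ x, φ (bPlus K x) = L (φ x)) (hL : ∀ a b, L (R a * b) = R a * L b) (x : HR K) :
    renormalize R φ (bPlus K x) = L (renormalize R φ x) - R (L (renormalize R φ x)) := by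
  set Z : HR K →ₐ[K] A := (R.comp φ).comp (HopfAlgebra.antipodeAlgHom K (HR K))
  have h_bPlus : renormalize R φ (bPlus K x) = Z (bPlus K x) + L (renormalize R φ x) :=
    convMul_bPlus hφ (fun _ _ => hL _ _) x
  have h_kernel : R (renormalize R φ (bPlus K x)) = 0 := by
    rw [projection_renormalize hR]
    exact (congrArg _ (counitHR_bPlus K x)).trans (map_zero _)
  have h_image : R (Z (bPlus K x)) = Z (bPlus K x) := hR _
  rw [h_bPlus, map_add, h_image] at h_kernel
  rw [h_bPlus, eq_neg_of_add_eq_zero_left h_kernel]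
  ring

@[elab_as_elim]
theorem HR_induction {P : HR K → Prop} (scalar : ∀ r, P (algebraMap K (HR K) r))
    (add : ∀ x y, P x → P y → P (x + y)) (mul : ∀ x y, P x → P y → P (x * y))
    (bPlus : ∀ s, P (forest K s) → P (bPlus K (forest K s))) (x : HR K) : P x := by
  have h_tree (t : RootedTree) : P (tree K t) := by
    induction t using RootedTree.graft_induction with
    | h s ih =>
      rw [← bPlus_forest]
      refine bPlus s (Multiset.prod_induction P _ mul ?_ fun a ha => ?_)
      · exact map_one (algebraMap K (HR K)) ▸ scalar 1
      · obtain ⟨t, ht, rfl⟩ := Multiset.mem_map.1 ha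
        exact ih t ht
  exact MvPolynomial.induction_on (motive := P) x scalar add fun y t hy => mul y _ hy (h_tree t)

end HopfAlgebras

section PolynomialCalculus

open Polynomial

section DifferentialOp

variable {K : Type*} [CommRing K]

/-- The differential operator `∑ c_n (d/dx)^n` of infinite order with constant coefficients on
polynomials, on which the sum is finite. -/
def differentialOp (c : ℕ → K) : K[X] →ₗ[K] K[X] :=
  Polynomial.lsum fun m => ∑ n ∈ Finset.range (m + 1), c n • ((derivative ^ n) ∘ₗ monomial m)

theorem differentialOp_eq_sum (c : ℕ → K) {p : K[X]} {N : ℕ} (hN : p.natDegree < N) :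
    differentialOp c p = ∑ n ∈ Finset.range N, c n • (derivative ^ n) p := by
  have h_monomial (m : ℕ) (a : K) (hm : m < N) :
      (∑ n ∈ Finset.range (m + 1), c n • ((derivative ^ n) ∘ₗ monomial m)) a =
        (∑ n ∈ Finset.range N, c n • derivative ^ n) (monomial m a) := by
    simp only [LinearMap.sum_apply, LinearMap.smul_apply, LinearMap.comp_apply,
      Module.End.pow_apply]
    refine Finset.sum_subset (Finset.range_subset_range.2 hm) fun n _ hn => ?_
    rw [iterate_derivative_eq_zero, smul_zero]
    exact (natDegree_monomial_le a).trans_lt (by simpa using hn)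
  calc differentialOp c p
      = ∑ m ∈ p.support, (∑ n ∈ Finset.range N, c n • derivative ^ n) (monomial m (p.coeff m)) :=
        Finset.sum_congr rfl fun m hm =>
          h_monomial m _ ((le_natDegree_of_mem_supp m hm).trans_lt hN)
    _ = (∑ n ∈ Finset.range N, c n • derivative ^ n) p := by
        rw [← map_sum, ← as_sum_support]
    _ = ∑ n ∈ Finset.range N, c n • (derivative ^ n) p := by
        simp only [LinearMap.sum_apply, LinearMap.smul_apply]

theorem coeff_differentialOp (c : ℕ → K) {p : K[X]} {N : ℕ} (hN : p.natDegree < N) (j : ℕ) :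
    (differentialOp c p).coeff j =
      ∑ n ∈ Finset.range N, c n * ((j + n).descFactorial n * p.coeff (j + n)) := by
  rw [differentialOp_eq_sum c hN, finsetSum_coeff]
  simp only [coeff_smul, Module.End.pow_apply, coeff_iterate_derivative, smul_eq_mul,
    nsmul_eq_mul]

theorem map_differentialOp {L : Type*} [CommRing L] (f : K →+* L) (c : ℕ → K) (p : K[X]) :
    (differentialOp c p).map f = differentialOp (f ∘ c) (p.map f) := by
  rw [differentialOp_eq_sum c p.natDegree.lt_succ_self,
    differentialOp_eq_sum _ (natDegree_map_le.trans_lt p.natDegree.lt_succ_self),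
    Polynomial.map_sum]
  simp only [Polynomial.map_smul, Module.End.pow_apply, iterate_derivative_map,
    Function.comp_apply]

theorem comul_derivative (p : K[X]) :
    Coalgebra.comul (R := K) (derivative p) =
      derivative.lTensor K[X] (Coalgebra.comul (R := K) p) := by
  have h_mul_X (y : K[X] ⊗[K] K[X]) :
      derivative.lTensor K[X] (y * Coalgebra.comul (R := K) X) =
        derivative.lTensor K[X] y * Coalgebra.comul (R := K) X + y := by
    rw [comul_X]
    induction y using TensorProduct.induction_on with
    | zero => simp
    | add y₁ y₂ h₁ h₂ => rw [add_mul, map_add, h₁, h₂, map_add, add_mul]; abel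
    | tmul a b => simp [mul_add, TensorProduct.tmul_add, add_assoc]
  induction p using Polynomial.induction_on with
  | C a =>
    rw [derivative_C, map_zero, ← algebraMap_eq, Bialgebra.comul_algebraMap,
      Algebra.TensorProduct.algebraMap_apply]
    simp
  | add p q hp hq => simp only [map_add, hp, hq]
  | monomial n a ih =>
    rw [pow_succ, ← mul_assoc, Bialgebra.comul_mul, h_mul_X, derivative_mul, derivative_X, mul_one,
      map_add, Bialgebra.comul_mul, ih]

theorem comul_derivative_pow (n : ℕ) (p : K[X]) :
    Coalgebra.comul (R := K) ((derivative ^ n) p) =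
      (derivative ^ n).lTensor K[X] (Coalgebra.comul (R := K) p) := by
  induction n generalizing p with
  | zero => rw [pow_zero, Module.End.one_eq_id, LinearMap.lTensor_id]; rfl
  | succ n ih =>
    rw [pow_succ, Module.End.mul_apply, ih, comul_derivative, ← LinearMap.lTensor_comp_apply,
      Module.End.mul_eq_comp]

theorem eventually_lTensor_differentialOp {M : Type*} [AddCommGroup M] [Module K M] (c : ℕ → K)
    (y : M ⊗[K] K[X]) :
    ∀ᶠ N in Filter.atTop, (differentialOp c).lTensor M y =
      ∑ n ∈ Finset.range N, c n • (derivative ^ n).lTensor M y := by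
  induction y using TensorProduct.induction_on with
  | zero => simp
  | add y₁ y₂ h₁ h₂ =>
    filter_upwards [h₁, h₂] with N h₁ h₂
    simp only [map_add, h₁, h₂, smul_add, Finset.sum_add_distrib]
  | tmul m p =>
    filter_upwards [Filter.eventually_gt_atTop p.natDegree] with N hN
    simp only [LinearMap.lTensor_tmul, differentialOp_eq_sum c hN, TensorProduct.tmul_sum,
      TensorProduct.tmul_smul]

theorem comul_differentialOp (c : ℕ → K) (p : K[X]) :
    Coalgebra.comul (R := K) (differentialOp c p) =
      (differentialOp c).lTensor K[X] (Coalgebra.comul (R := K) p) := by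
  obtain ⟨N, hN, hp⟩ := ((eventually_lTensor_differentialOp c
    (Coalgebra.comul (R := K) p)).and (Filter.eventually_gt_atTop p.natDegree)).exists
  simp only [hN, differentialOp_eq_sum c hp, map_sum, map_smul, comul_derivative_pow]

end DifferentialOp

section Antiderivative

variable {K : Type*} [Field K]

/-- The antiderivative `∫₀` of polynomials, with vanishing constant coefficient. -/
def antiderivative : K[X] →ₗ[K] K[X] :=
  Polynomial.lsum fun m => (m + 1 : K)⁻¹ • monomial (m + 1)

theorem antiderivative_monomial (m : ℕ) (a : K) :
    antiderivative (monomial m a) = monomial (m + 1) ((m + 1 : K)⁻¹ * a) := by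
  simp [antiderivative, smul_monomial]

theorem coeff_zero_antiderivative (p : K[X]) : (antiderivative p).coeff 0 = 0 := by
  induction p using Polynomial.induction_on' with
  | add p q hp hq => rw [map_add, coeff_add, hp, hq, add_zero]
  | monomial m a => rw [antiderivative_monomial, coeff_monomial_succ]

theorem coeff_succ_antiderivative (p : K[X]) (j : ℕ) :
    (antiderivative p).coeff (j + 1) = (j + 1 : K)⁻¹ * p.coeff j := by
  induction p using Polynomial.induction_on' with
  | add p q hp hq => rw [map_add, coeff_add, hp, hq, coeff_add, mul_add]
  | monomial m a =>
    rw [antiderivative_monomial, coeff_monomial, coeff_monomial]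
    rcases eq_or_ne m j with rfl | h
    · simp
    · simp [h]

theorem map_antiderivative {L : Type*} [Field L] (f : K →+* L) (p : K[X]) :
    (antiderivative p).map f = antiderivative (p.map f) := by
  ext (_ | j)
  · simp only [coeff_map, coeff_zero_antiderivative, map_zero]
  · simp only [coeff_map, coeff_succ_antiderivative, map_mul, map_inv₀, map_add, map_natCast,
      map_one]

variable [CharZero K]

theorem derivative_antiderivative (p : K[X]) : derivative (antiderivative p) = p := by
  ext j
  rw [coeff_derivative, coeff_succ_antiderivative]
  field_simp

theorem antiderivative_derivative (p : K[X]) :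
    antiderivative (derivative p) = p - C (p.coeff 0) := by
  ext (_ | j)
  · simp [coeff_zero_antiderivative]
  · rw [coeff_succ_antiderivative, coeff_derivative, coeff_sub, coeff_C_succ]
    field_simp
    ring

theorem lTensor_antiderivative_derivative (y : K[X] ⊗[K] K[X]) :
    antiderivative.lTensor K[X] (derivative.lTensor K[X] y) =
      y - TensorProduct.rid K K[X] (Coalgebra.counit.lTensor K[X] y) ⊗ₜ[K] 1 := by
  induction y using TensorProduct.induction_on with
  | zero => simp
  | add y₁ y₂ h₁ h₂ => simp only [map_add, h₁, h₂, TensorProduct.add_tmul]; abel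
  | tmul a b =>
    have h_counit : Coalgebra.counit (R := K) b = b.coeff 0 := by
      rw [coeff_zero_eq_aeval_zero]; rfl
    rw [LinearMap.lTensor_tmul, LinearMap.lTensor_tmul, antiderivative_derivative,
      LinearMap.lTensor_tmul, TensorProduct.rid_tmul, TensorProduct.tmul_sub, h_counit,
      TensorProduct.smul_tmul, Algebra.smul_def, mul_one, algebraMap_eq]

theorem isHochschildCocycle_antiderivative :
    IsHochschildCocycle (antiderivative : K[X] →ₗ[K] K[X]) := fun p => by
  have h := lTensor_antiderivative_derivative (Coalgebra.comul (R := K) (antiderivative p))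
  rw [← comul_derivative, derivative_antiderivative, Coalgebra.lTensor_counit_comul,
    TensorProduct.rid_tmul, one_smul] at h
  rw [h, add_sub_cancel]

end Antiderivative

/-- The cocycle `-∫₀ H(-d/dx)`, for the power series `H = ∑ c_n w^n`, which takes the place of the
regularized integral operator in the physical limit. -/
def physicalOp {K : Type*} [Field K] (c : ℕ → K) : K[X] →ₗ[K] K[X] :=
  -(antiderivative ∘ₗ differentialOp fun n => (-1) ^ n * c n)

section PhysicalOp

variable {K : Type*} [Field K]

theorem isHochschildCocycle_physicalOp [CharZero K] (c : ℕ → K) :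
    IsHochschildCocycle (physicalOp c) :=
  (isHochschildCocycle_antiderivative.comp (comul_differentialOp _)).neg

theorem coeff_zero_physicalOp (c : ℕ → K) (p : K[X]) : (physicalOp c p).coeff 0 = 0 := by
  rw [physicalOp, LinearMap.neg_apply, coeff_neg, LinearMap.comp_apply, coeff_zero_antiderivative,
    neg_zero]

theorem coeff_succ_physicalOp (c : ℕ → K) (p : K[X]) (j : ℕ) :
    (physicalOp c p).coeff (j + 1) =
      -((j + 1 : K)⁻¹ * (differentialOp (fun n => (-1) ^ n * c n) p).coeff j) := by
  rw [physicalOp, LinearMap.neg_apply, coeff_neg, LinearMap.comp_apply, coeff_succ_antiderivative]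

theorem map_physicalOp {L : Type*} [Field L] (f : K →+* L) (c : ℕ → K) (p : K[X]) :
    (physicalOp c p).map f = physicalOp (f ∘ c) (p.map f) := by
  have h_coeff : (f ∘ fun n => (-1) ^ n * c n) = fun n => (-1) ^ n * (f ∘ c) n := by
    ext n; simp
  simp only [physicalOp, LinearMap.neg_apply, Polynomial.map_neg, LinearMap.comp_apply,
    map_antiderivative, map_differentialOp, h_coeff]

end PhysicalOp

theorem map_universalHom_physicalOp {K L : Type*} [Field K] [Field L] [Algebra K L] (c : ℕ → K)
    (x : HR K) : (universalHom K (physicalOp c) x).map (algebraMap K L) =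
      universalHom K (physicalOp (algebraMap K L ∘ c)) x := by
  have h : (mapAlgHom (Algebra.ofId K L)).comp (universalHom K (physicalOp c)) =
      universalHom K (physicalOp (algebraMap K L ∘ c)) := by
    refine algHom_ext_bPlus fun s ih => ?_
    rw [AlgHom.comp_apply, universalHom_bPlus_forest, universalHom_bPlus_forest, ← ih]
    exact map_physicalOp (algebraMap K L) c _
  exact DFunLike.congr_fun h x

end PolynomialCalculus

/-- The algebra of the functions of the regulator that are meromorphic at `0`. -/
def meromorphicAtZero : Subalgebra ℂ (ℂ → ℂ) where
  carrier := {g | MeromorphicAt g 0}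
  mul_mem' := MeromorphicAt.mul
  add_mem' := MeromorphicAt.add
  algebraMap_mem' c := MeromorphicAt.const c 0

local notation "𝓜" => meromorphicAtZero

instance : CommRing 𝓜 := Subalgebra.toCommRing _

section MeromorphicPolynomials

open Polynomial

/-- The function `z ↦ h (k z)`. -/
def dilate (k : ℕ) (h : 𝓜) : 𝓜 :=
  ⟨fun z => h.1 (k * z), MeromorphicAt.comp_analyticAt (g := fun z : ℂ => k * z)
    (show MeromorphicAt h.1 (k * 0) from (mul_zero (k : ℂ)).symm ▸ h.2) (by fun_prop)⟩

/-- The operator that multiplies the coefficient of `X ^ k` by `z ↦ h (k z)`. When `X` stands for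
`e^(-zℓ)`, this is the operator `h (-d/dℓ)`. -/
def multiplier (h : 𝓜) : 𝓜[X] →ₗ[𝓜] 𝓜[X] :=
  Polynomial.lsum fun k => dilate k h • monomial k

theorem multiplier_monomial (h : 𝓜) (k : ℕ) (b : 𝓜) :
    multiplier h (monomial k b) = monomial k (dilate k h * b) := by
  simp [multiplier, smul_monomial]

/-- The toy model integral operator `a ↦ F (-d/dℓ) (u X a)`, in terms of the variable
`X = (s/μ)^(-z)`, with `F` the Mellin transform of the kernel and `u = μ^(-z)`. -/
def feynmanOp (F u : 𝓜) : 𝓜[X] →ₗ[𝓜] 𝓜[X] :=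
  multiplier F ∘ₗ LinearMap.mulLeft 𝓜 (C u * X)

theorem feynmanOp_apply (F u : 𝓜) (a : 𝓜[X]) :
    feynmanOp F u a = multiplier F (C u * X * a) := rfl

theorem feynmanOp_monomial (F u : 𝓜) (k : ℕ) (b : 𝓜) :
    feynmanOp F u (monomial k b) = monomial (k + 1) (dilate (k + 1) F * (u * b)) := by
  rw [feynmanOp_apply, C_mul_X_eq_monomial, monomial_mul_monomial, multiplier_monomial,
    Nat.add_comm 1 k]

variable (K : Type*) [Field K] [Algebra K ℂ]

/-- The projection `a ↦ a(1)` onto the constants, which is the momentum scheme in terms of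
`X = (s/μ)^(-z)`. -/
def evalOne : 𝓜[X] →ₐ[K] 𝓜[X] :=
  (CAlgHom.comp (aeval (1 : 𝓜))).restrictScalars K

theorem evalOne_apply (a : 𝓜[X]) : evalOne K a = C (a.eval 1) := by
  simp [evalOne, coe_aeval_eq_eval]

theorem evalOne_evalOne (a : 𝓜[X]) : evalOne K (evalOne K a) = evalOne K a := by
  rw [evalOne_apply, evalOne_apply, eval_C]

theorem feynmanOp_evalOne_mul (F u : 𝓜) (a b : 𝓜[X]) :
    feynmanOp F u (evalOne K a * b) = evalOne K a * feynmanOp F u b := by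
  rw [evalOne_apply, ← smul_eq_C_mul, ← smul_eq_C_mul, map_smul]

/-- The inclusion of the functions of the regulator among those of the regulator and the scale. -/
def scaleConst : 𝓜 →ₐ[K] (ℂ → ℝ → ℂ) where
  toFun h := fun z _ => h.1 z
  map_one' := rfl
  map_mul' _ _ := rfl
  map_zero' := rfl
  map_add' _ _ := rfl
  commutes' _ := rfl

/-- The substitution `X = (s/μ)^(-z)`, which turns polynomials with meromorphic coefficients into
functions of the regulator `z` and the scale `s`. -/
def scaleEval (μ : ℝ) : 𝓜[X] →ₐ[K] (ℂ → ℝ → ℂ) :=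
  eval₂AlgHom (scaleConst K) (fun z s => ((s / μ : ℝ) : ℂ) ^ (-z)) fun _ => Commute.all _ _

theorem scaleEval_apply (μ : ℝ) (a : 𝓜[X]) (z : ℂ) (s : ℝ) :
    scaleEval K μ a z s = a.sum fun k b => b.1 z * (((s / μ : ℝ) : ℂ) ^ (-z)) ^ k := by
  rw [scaleEval, eval₂AlgHom_apply, eval₂_eq_sum]
  simp only [Polynomial.sum_def, Finset.sum_apply]
  rfl

theorem scaleEval_monomial (μ : ℝ) (k : ℕ) (b : 𝓜) (z : ℂ) (s : ℝ) :
    scaleEval K μ (monomial k b) z s = b.1 z * (((s / μ : ℝ) : ℂ) ^ (-z)) ^ k := by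
  rw [scaleEval_apply, sum_monomial_index]
  simp

theorem scaleEval_evalOne {μ : ℝ} (hμ : μ ≠ 0) (a : 𝓜[X]) :
    scaleEval K μ (evalOne K a) = momentumScheme K μ (scaleEval K μ a) := by
  induction a using Polynomial.induction_on' with
  | add a b ha hb => simp only [map_add, ha, hb]
  | monomial k b =>
    ext z s
    change _ = scaleEval K μ (monomial k b) z μ
    rw [evalOne_apply, eval_monomial, one_pow, mul_one, ← monomial_zero_left, scaleEval_monomial,
      scaleEval_monomial, div_self hμ, Complex.ofReal_one, Complex.one_cpow, one_pow, pow_zero]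

end MeromorphicPolynomials

section HalfPlane

open Filter MeasureTheory

/-- The filter of the neighbourhoods of `0` in the half-plane `Re z > 0`. -/
abbrev nhdsHalfPlane : Filter ℂ := 𝓝[{z | 0 < z.re}] 0

theorem halfPlane_le_punctured : nhdsHalfPlane ≤ 𝓝[≠] 0 :=
  nhdsWithin_mono _ fun z (hz : 0 < z.re) h => by
    rw [Set.mem_singleton_iff] at h
    simp [h] at hz

instance halfPlane_neBot : NeBot nhdsHalfPlane := by
  rw [← mem_closure_iff_nhdsWithin_neBot, Complex.closure_setOfPred_lt_re]
  exact le_refl (0 : ℝ)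

theorem tendsto_natCast_mul_halfPlane {k : ℕ} (hk : k ≠ 0) :
    Tendsto (fun z : ℂ => k * z) nhdsHalfPlane nhdsHalfPlane := by
  refine tendsto_nhdsWithin_iff.2 ⟨?_, ?_⟩
  · exact (Continuous.tendsto' (by fun_prop) 0 0 (mul_zero _)).mono_left nhdsWithin_le_nhds
  · filter_upwards [self_mem_nhdsWithin] with z hz
    have h_re : ((k : ℂ) * z).re = k * z.re := by simp [Complex.mul_re]
    exact h_re ▸ mul_pos (by positivity) hz

theorem eventually_integrableOn_kernel {f : ℝ → ℂ}
    (hf : ∀ᶠ σ : ℝ in 𝓝[>] 0, IntegrableOn (fun ζ : ℝ => f ζ * (ζ : ℂ) ^ (-(σ : ℂ))) (Set.Ioi 0)) :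
    ∀ᶠ z in nhdsHalfPlane, IntegrableOn (fun ζ : ℝ => f ζ * (ζ : ℂ) ^ (-z)) (Set.Ioi 0) := by
  have h_re : Tendsto Complex.re nhdsHalfPlane (𝓝[>] 0) :=
    tendsto_nhdsWithin_iff.2 ⟨(Complex.continuous_re.tendsto' 0 0 Complex.zero_re).mono_left
      nhdsWithin_le_nhds, self_mem_nhdsWithin⟩
  filter_upwards [h_re.eventually hf] with z hz
  have h_phase : IntegrableOn (fun ζ : ℝ => f ζ * (ζ : ℂ) ^ (-(z.re : ℂ)) *
      (ζ : ℂ) ^ (-(z.im * Complex.I))) (Set.Ioi 0) := by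
    refine Integrable.mul_bdd (c := 1) hz
      (Complex.measurable_ofReal.pow_const _).aestronglyMeasurable ?_
    filter_upwards [ae_restrict_mem measurableSet_Ioi] with ζ hζ
    rw [Complex.norm_cpow_eq_rpow_re_of_pos hζ]
    simp
  refine h_phase.congr_fun (fun ζ hζ => ?_) measurableSet_Ioi
  simp only
  rw [mul_assoc, ← Complex.cpow_add _ _ (Complex.ofReal_ne_zero.2 (ne_of_gt hζ)), ← neg_add,
    Complex.re_add_im]

theorem hasFPowerSeriesAt_ofScalars_iff {H : ℂ → ℂ} {c : ℕ → ℂ} :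
    HasFPowerSeriesAt H (FormalMultilinearSeries.ofScalars ℂ c) 0 ↔
      ∀ᶠ w in 𝓝 0, HasSum (fun n => c n * w ^ n) (H w) := by
  rw [hasFPowerSeriesAt_iff]
  simp only [FormalMultilinearSeries.coeff_ofScalars, smul_eq_mul, mul_comm, zero_add]

theorem exists_hasSum_of_hasSum_laurent {F : ℂ → ℂ} {c : ℕ → ℂ}
    (hF : ∀ᶠ z in nhdsHalfPlane, HasSum (fun n : ℕ => c n * z ^ ((n : ℤ) - 1)) (F z)) :
    ∃ H : ℂ → ℂ, (∀ᶠ w in 𝓝 0, HasSum (fun n => c n * w ^ n) (H w)) ∧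
      ∀ᶠ z in nhdsHalfPlane, F z = H z / z := by
  set p := FormalMultilinearSeries.ofScalars ℂ c with hp
  have h_ne : ∀ᶠ z in nhdsHalfPlane, z ≠ 0 := halfPlane_le_punctured self_mem_nhdsWithin
  have h_sum : ∀ᶠ z in nhdsHalfPlane, HasSum (fun n : ℕ => c n * z ^ n) (F z * z) := by
    filter_upwards [hF, h_ne] with z hz hz0
    refine (hz.mul_right z).congr_fun fun n => ?_
    rw [mul_assoc, ← zpow_add_one₀ hz0, sub_add_cancel, zpow_natCast]
  have h_radius : 0 < p.radius := by
    obtain ⟨z, hz, hz0⟩ := (h_sum.and h_ne).exists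
    have h_norm (n : ℕ) : ‖p n‖ = ‖c n‖ := by
      rw [FormalMultilinearSeries.norm_apply_eq_norm_coef, hp,
        FormalMultilinearSeries.coeff_ofScalars]
    have h_le : ((‖z‖₊ : NNReal) : ENNReal) ≤ p.radius := by
      refine p.le_radius_of_tendsto (l := 0) ?_
      simpa [h_norm] using hz.summable.tendsto_atTop_zero.norm
    exact (ENNReal.coe_pos.2 (nnnorm_pos.2 hz0)).trans_le h_le
  refine ⟨p.sum, hasFPowerSeriesAt_ofScalars_iff.1
    (p.hasFPowerSeriesOnBall h_radius).hasFPowerSeriesAt, ?_⟩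
  filter_upwards [h_sum, h_ne] with z hz hz0
  have h_eq : p.sum z = F z * z := by
    rw [← hz.tsum_eq]
    exact tsum_congr fun n => by
      rw [hp, FormalMultilinearSeries.ofScalars_apply_eq, smul_eq_mul]
  rw [h_eq, mul_div_cancel_right₀ _ hz0]

end HalfPlane

section Germs

open Filter MeasureTheory Polynomial

/-- The ideal of the functions of the regulator `z` and the scale `s` that vanish for all positive
scales when `z` is close to `0` in the half-plane `Re z > 0`. -/
def negligible : Ideal (ℂ → ℝ → ℂ) where
  carrier := {g | ∀ᶠ z in nhdsHalfPlane, ∀ s, 0 < s → g z s = 0}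
  zero_mem' := by simp
  add_mem' {g h} hg hh := by
    rw [Set.mem_ofPred_eq] at hg hh ⊢
    filter_upwards [hg, hh] with z hg hh s hs
    simp [hg s hs, hh s hs]
  smul_mem' g h hh := by
    rw [Set.mem_ofPred_eq] at hh ⊢
    filter_upwards [hh] with z hh s hs
    simp [hh s hs]

theorem mem_negligible {g : ℂ → ℝ → ℂ} :
    g ∈ negligible ↔ ∀ᶠ z in nhdsHalfPlane, ∀ s, 0 < s → g z s = 0 := by
  rfl

variable (K : Type*) [Field K] [Algebra K ℂ]

/-- The germ at `z = 0`, in the half-plane `Re z > 0`, of a function of the regulator `z` and the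
scale `s > 0`. -/
def germ : (ℂ → ℝ → ℂ) →ₐ[K] (ℂ → ℝ → ℂ) ⧸ negligible := Ideal.Quotient.mkₐ K negligible

theorem germ_eq_germ_iff {g h : ℂ → ℝ → ℂ} :
    germ K g = germ K h ↔ ∀ᶠ z in nhdsHalfPlane, ∀ s, 0 < s → g z s = h z s := by
  refine Ideal.Quotient.eq.trans ?_
  simp only [mem_negligible, Pi.sub_apply, sub_eq_zero]

theorem germ_momentumScheme_congr {μ : ℝ} (hμ : 0 < μ) {g h : ℂ → ℝ → ℂ}
    (hgh : germ K g = germ K h) :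
    germ K (momentumScheme K μ g) = germ K (momentumScheme K μ h) := by
  rw [germ_eq_germ_iff] at hgh ⊢
  filter_upwards [hgh] with z hz s _
  exact hz μ hμ

theorem germ_toyOp_congr (f : ℝ → ℂ) {g h : ℂ → ℝ → ℂ} (hgh : germ K g = germ K h) :
    germ K (toyOp f g) = germ K (toyOp f h) := by
  rw [germ_eq_germ_iff] at hgh ⊢
  filter_upwards [hgh] with z hz s hs
  refine setIntegral_congr_fun measurableSet_Ioi fun ζ hζ => ?_
  simp only [hz (s * ζ) (mul_pos hs hζ)]

/-- The function `z ↦ μ^(-z)`, for `μ > 0`. -/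
def scaleFactor (μ : ℝ) : 𝓜 :=
  ⟨fun z => Complex.exp (-z * Real.log μ), AnalyticAt.meromorphicAt (by fun_prop)⟩

theorem scaleFactor_apply {μ : ℝ} (hμ : 0 < μ) (z : ℂ) :
    (scaleFactor μ).1 z = (μ : ℂ) ^ (-z) := by
  rw [Complex.cpow_def_of_ne_zero (Complex.ofReal_ne_zero.2 hμ.ne'), ← Complex.ofReal_log hμ.le,
    mul_comm, scaleFactor]

theorem kernel_mul_scaleEval_monomial (f : ℝ → ℂ) {μ s ζ : ℝ} (hμ : 0 < μ) (hs : 0 < s)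
    (hζ : 0 < ζ) (k : ℕ) (b : 𝓜) (z : ℂ) :
    f ζ * ((s * ζ : ℝ) : ℂ) ^ (-z) * scaleEval K μ (monomial k b) z (s * ζ) =
      b.1 z * (scaleFactor μ).1 z * (((s / μ : ℝ) : ℂ) ^ (-z)) ^ (k + 1) *
        (f ζ * (ζ : ℂ) ^ (-(((k + 1 : ℕ) : ℂ) * z))) := by
  have h_scale : ((s * ζ : ℝ) : ℂ) ^ (-z) =
      (scaleFactor μ).1 z * ((s / μ : ℝ) : ℂ) ^ (-z) * (ζ : ℂ) ^ (-z) := by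
    rw [scaleFactor_apply hμ, ← Complex.mul_cpow_ofReal_nonneg hμ.le (by positivity),
      ← Complex.ofReal_mul, mul_div_cancel₀ _ hμ.ne',
      ← Complex.mul_cpow_ofReal_nonneg hs.le hζ.le, Complex.ofReal_mul]
  have h_ratio : ((s * ζ / μ : ℝ) : ℂ) ^ (-z) =
      ((s / μ : ℝ) : ℂ) ^ (-z) * (ζ : ℂ) ^ (-z) := by
    rw [mul_div_right_comm, Complex.ofReal_mul,
      Complex.mul_cpow_ofReal_nonneg (by positivity) hζ.le]
  rw [scaleEval_monomial, h_scale, h_ratio, ← mul_neg, Complex.cpow_nat_mul]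
  ring

theorem toyRenormalized_eq_renormalize (f : ℝ → ℂ) (μ : ℝ) :
    toyRenormalized K f μ = renormalize (momentumScheme K μ) (toyRule K f) := rfl

section Integral

variable {K} {f : ℝ → ℂ}
  (hf : ∀ᶠ z in nhdsHalfPlane, IntegrableOn (fun ζ : ℝ => f ζ * (ζ : ℂ) ^ (-z)) (Set.Ioi 0))

include hf

theorem eventually_integrableOn_scaleEval {μ : ℝ} (hμ : 0 < μ) (a : 𝓜[X]) :
    ∀ᶠ z in nhdsHalfPlane, ∀ s : ℝ, 0 < s → IntegrableOn
      (fun ζ : ℝ => f ζ * ((s * ζ : ℝ) : ℂ) ^ (-z) * scaleEval K μ a z (s * ζ)) (Set.Ioi 0) := by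
  induction a using Polynomial.induction_on' with
  | add a b ha hb =>
    filter_upwards [ha, hb] with z ha hb s hs
    simp only [map_add, Pi.add_apply, mul_add]
    exact (ha s hs).add (hb s hs)
  | monomial k b =>
    filter_upwards [(tendsto_natCast_mul_halfPlane k.succ_ne_zero).eventually hf] with z hz s hs
    exact IntegrableOn.congr_fun (hz.const_mul _)
      (fun ζ hζ => (kernel_mul_scaleEval_monomial K f hμ hs hζ k b z).symm) measurableSet_Ioi

variable {F : 𝓜} (hF : ∀ᶠ z in nhdsHalfPlane, ∫ ζ in Set.Ioi (0 : ℝ), f ζ * (ζ : ℂ) ^ (-z) = F.1 z)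

include hF

theorem germ_toyOp_scaleEval {μ : ℝ} (hμ : 0 < μ) (a : 𝓜[X]) :
    germ K (toyOp f (scaleEval K μ a)) =
      germ K (scaleEval K μ (feynmanOp F (scaleFactor μ) a)) := by
  rw [germ_eq_germ_iff]
  induction a using Polynomial.induction_on' with
  | add a b ha hb =>
    filter_upwards [ha, hb, eventually_integrableOn_scaleEval (K := K) hf hμ a,
      eventually_integrableOn_scaleEval (K := K) hf hμ b] with z ha hb ha_int hb_int s hs
    simp only [map_add, Pi.add_apply, ← ha s hs, ← hb s hs, toyOp, mul_add]
    exact integral_add (ha_int s hs) (hb_int s hs)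
  | monomial k b =>
    filter_upwards [(tendsto_natCast_mul_halfPlane k.succ_ne_zero).eventually hF] with z hz s hs
    have h_congr := setIntegral_congr_fun (μ := volume) measurableSet_Ioi
      fun ζ (hζ : 0 < ζ) => kernel_mul_scaleEval_monomial K f hμ hs hζ k b z
    rw [toyOp, h_congr, integral_const_mul, hz, feynmanOp_monomial, scaleEval_monomial]
    change _ = F.1 (((k + 1 : ℕ) : ℂ) * z) * ((scaleFactor μ).1 z * b.1 z) * _
    ring

theorem germ_comp_toyRule {μ : ℝ} (hμ : 0 < μ) :
    (germ K).comp (toyRule K f) = ((germ K).comp (scaleEval K μ)).comp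
      (universalHom K (feynmanOp F (scaleFactor μ))) := by
  refine algHom_ext_bPlus fun x ih => ?_
  simp only [AlgHom.comp_apply] at ih ⊢
  rw [toyRule, universalHom_bPlus_forest, universalHom_bPlus_forest, ← toyRule,
    germ_toyOp_congr K f ih, germ_toyOp_scaleEval hf hF hμ]

theorem eventually_integrableOn_toyRule (x : HR K) :
    ∀ᶠ z in nhdsHalfPlane, ∀ s : ℝ, 0 < s → IntegrableOn
      (fun ζ : ℝ => f ζ * ((s * ζ : ℝ) : ℂ) ^ (-z) * toyRule K f x z (s * ζ)) (Set.Ioi 0) := by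
  have h_germ := (germ_eq_germ_iff K).1
    (DFunLike.congr_fun (germ_comp_toyRule hf hF one_pos) x)
  filter_upwards [h_germ, eventually_integrableOn_scaleEval (K := K) hf one_pos
    (universalHom K (feynmanOp F (scaleFactor 1)) x)] with z h_eq h_int s hs
  refine (h_int s hs).congr_fun (fun ζ hζ => ?_) measurableSet_Ioi
  exact congrArg _ (h_eq _ (mul_pos hs hζ)).symm

theorem germ_comp_toyRenormalized {μ : ℝ} (hμ : 0 < μ) :
    (germ K).comp (toyRenormalized K f μ) = ((germ K).comp (scaleEval K μ)).comp
      (renormalize (evalOne K) (universalHom K (feynmanOp F (scaleFactor μ)))) := by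
  have h_rule := germ_comp_toyRule (K := K) hf hF hμ
  have h_counterterm : (germ K).comp ((momentumScheme K μ).comp (toyRule K f)) =
      ((germ K).comp (scaleEval K μ)).comp
        ((evalOne K).comp (universalHom K (feynmanOp F (scaleFactor μ)))) := by
    refine AlgHom.ext fun x => ?_
    simp only [AlgHom.comp_apply, scaleEval_evalOne K hμ.ne']
    exact germ_momentumScheme_congr K hμ (DFunLike.congr_fun h_rule x)
  rw [toyRenormalized_eq_renormalize]
  exact comp_renormalize_congr h_rule h_counterterm

end Integral

end Germs

section Limits

open Filter Polynomial Asymptotics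
open scoped PowerSeries PowerSeries.WithPiTopology

/-- The value of `h (d/dℓ) a` at `ℓ = 0`, where the variable of `a` stands for `e^(-zℓ)`. -/
def symbolEval (a : 𝓜[X]) (z : ℂ) : (ℂ → ℂ) →ₗ[ℂ] ℂ :=
  a.sum fun k b => b.1 z • LinearMap.proj (-(k * z))

theorem symbolEval_apply (a : 𝓜[X]) (z : ℂ) (h : ℂ → ℂ) :
    symbolEval a z h = a.sum fun k b => b.1 z * h (-(k * z)) := by
  simp [symbolEval, Polynomial.sum_def]

theorem symbolEval_monomial (k : ℕ) (b : 𝓜) (z : ℂ) (h : ℂ → ℂ) :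
    symbolEval (monomial k b) z h = b.1 z * h (-(k * z)) := by
  rw [symbolEval_apply, sum_monomial_index]
  simp

theorem symbolEval_add (a b : 𝓜[X]) (z : ℂ) (h : ℂ → ℂ) :
    symbolEval (a + b) z h = symbolEval a z h + symbolEval b z h := by
  simp only [symbolEval_apply]
  exact sum_add_index _ _ _ (fun _ => by simp) fun _ _ _ => add_mul _ _ _

theorem symbolEval_multiplier (g : 𝓜) (a : 𝓜[X]) (z : ℂ) (h : ℂ → ℂ) :
    symbolEval (multiplier g a) z h = symbolEval a z fun w => g.1 (-w) * h w := by
  induction a using Polynomial.induction_on' with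
  | add a b ha hb => rw [map_add, symbolEval_add, symbolEval_add, ha, hb]
  | monomial k b =>
    rw [multiplier_monomial, symbolEval_monomial, symbolEval_monomial, neg_neg]
    change g.1 (k * z) * b.1 z * _ = _
    ring

theorem symbolEval_congr {a : 𝓜[X]} (ha : a.coeff 0 = 0) {z : ℂ} (hz : z ≠ 0) {h₁ h₂ : ℂ → ℂ}
    (h : ∀ w, w ≠ 0 → h₁ w = h₂ w) : symbolEval a z h₁ = symbolEval a z h₂ := by
  simp only [symbolEval_apply]
  refine Finset.sum_congr rfl fun k hk => ?_
  have hk0 : k ≠ 0 := fun h0 => mem_support_iff.1 hk (h0 ▸ ha)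
  simp only [h _ (neg_ne_zero.2 (mul_ne_zero (Nat.cast_ne_zero.2 hk0) hz))]

theorem scaleEval_eq_symbolEval (K : Type*) [Field K] [Algebra K ℂ] {μ s : ℝ} (hsμ : 0 < s / μ)
    (a : 𝓜[X]) (z : ℂ) :
    scaleEval K μ a z s = symbolEval a z fun w => Complex.exp (Real.log (s / μ) * w) := by
  rw [scaleEval_apply, symbolEval_apply]
  congr! 3 with k b
  rw [Complex.cpow_def_of_ne_zero (Complex.ofReal_ne_zero.2 hsμ.ne'), ← Complex.ofReal_log hsμ.le,
    ← Complex.exp_nat_mul]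
  ring_nf

theorem meromorphicAt_symbolEval_exp (a : 𝓜[X]) (l : ℂ) :
    MeromorphicAt (fun z => symbolEval a z fun w => Complex.exp (l * w)) 0 := by
  simp only [symbolEval_apply, Polynomial.sum_def]
  exact MeromorphicAt.fun_sum fun k _ =>
    (a.coeff k).2.mul (AnalyticAt.meromorphicAt (by fun_prop))

/-- The expansion in `ℓ` of a polynomial in `X = e^(-zℓ)`, at a given value of the regulator. -/
def expansion (z : ℂ) : 𝓜[X] →+* ℂ⟦X⟧ :=
  eval₂RingHom ((PowerSeries.C (R := ℂ)).comp
    ((Pi.evalRingHom (fun _ => ℂ) z).comp meromorphicAtZero.val.toRingHom))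
    (PowerSeries.rescale (-z) (PowerSeries.exp ℂ))

theorem expansion_C (z : ℂ) (b : 𝓜) : expansion z (C b) = PowerSeries.C (b.1 z) :=
  eval₂_C _ _

theorem expansion_X (z : ℂ) : expansion z X = PowerSeries.rescale (-z) (PowerSeries.exp ℂ) :=
  eval₂_X _ _

theorem coeff_expansion (z : ℂ) (a : 𝓜[X]) (j : ℕ) :
    PowerSeries.coeff j (expansion z a) = symbolEval a z fun w => w ^ j / j.factorial := by
  induction a using Polynomial.induction_on' with
  | add a b ha hb => rw [map_add, map_add, ha, hb, symbolEval_add]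
  | monomial k b =>
    rw [← C_mul_X_pow_eq_monomial, map_mul, map_pow, expansion_C, expansion_X, ← map_pow,
      PowerSeries.exp_pow_eq_rescale_exp, PowerSeries.coeff_C_mul, PowerSeries.coeff_rescale,
      PowerSeries.coeff_rescale, PowerSeries.coeff_exp, C_mul_X_pow_eq_monomial,
      symbolEval_monomial]
    simp only [map_div₀, map_one, map_natCast]
    rw [show -((k : ℂ) * z) = -z * k by ring, mul_pow]
    ring

theorem symbolEval_pow (z : ℂ) (a : 𝓜[X]) (j : ℕ) :
    symbolEval a z (fun w => w ^ j) = j.factorial * PowerSeries.coeff j (expansion z a) := by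
  have h_smul : (fun w : ℂ => w ^ j) = (j.factorial : ℂ) • fun w : ℂ => w ^ j / j.factorial := by
    ext w
    exact (mul_div_cancel₀ _ (Nat.cast_ne_zero.2 j.factorial_ne_zero)).symm
  rw [coeff_expansion, h_smul, map_smul, smul_eq_mul]

theorem coeff_zero_expansion (z : ℂ) (a : 𝓜[X]) :
    PowerSeries.coeff 0 (expansion z a) = (a.eval 1).1 z := by
  induction a using Polynomial.induction_on' with
  | add a b ha hb => rw [map_add, map_add, ha, hb, eval_add]; rfl
  | monomial k b =>
    rw [coeff_expansion, symbolEval_monomial, eval_monomial]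
    simp

theorem eventually_tendsto_mul_zero {b : ℂ → ℂ} (hb : MeromorphicAt b 0) :
    ∀ᶠ N : ℕ in atTop, ∀ r : ℂ → ℂ, r =O[𝓝 0] (fun w => w ^ N) →
      Tendsto (fun z => b z * r z) (𝓝[≠] 0) (𝓝 0) := by
  obtain ⟨n, hn⟩ := hb
  filter_upwards [eventually_gt_atTop n] with N hN r hr
  have h_analytic : Tendsto (fun z : ℂ => (z - 0) ^ n • b z) (𝓝[≠] 0) (𝓝 _) :=
    hn.continuousAt.tendsto.mono_left nhdsWithin_le_nhds
  have h_quotient : Tendsto (fun z : ℂ => r z / z ^ n) (𝓝[≠] 0) (𝓝 0) :=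
    ((hr.trans_isLittleO (isLittleO_pow_pow hN)).mono nhdsWithin_le_nhds).tendsto_div_nhds_zero
  have h_mul := h_analytic.mul h_quotient
  rw [mul_zero] at h_mul
  refine h_mul.congr' ?_
  filter_upwards [self_mem_nhdsWithin] with z hz
  have h_pow : z ^ n ≠ 0 := pow_ne_zero n hz
  rw [sub_zero, smul_eq_mul]
  field_simp

theorem eventually_tendsto_symbolEval_zero (a : 𝓜[X]) :
    ∀ᶠ N : ℕ in atTop, ∀ r : ℂ → ℂ, r =O[𝓝 0] (fun w => w ^ N) →
      Tendsto (fun z => symbolEval a z r) (𝓝[≠] 0) (𝓝 0) := by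
  induction a using Polynomial.induction_on' with
  | add a b ha hb =>
    filter_upwards [ha, hb] with N ha hb r hr
    simpa only [symbolEval_add, add_zero] using (ha r hr).add (hb r hr)
  | monomial k b =>
    filter_upwards [eventually_tendsto_mul_zero b.2] with N hN r hr
    simp only [symbolEval_monomial]
    refine hN (fun z => r (-(k * z))) ?_
    have h_tendsto : Tendsto (fun z : ℂ => -(k * z)) (𝓝 0) (𝓝 0) :=
      Continuous.tendsto' (by fun_prop) 0 0 (by simp)
    have h_linear : (fun z : ℂ => -(k * z)) =O[𝓝 0] fun z => z :=
      ((isBigO_refl _ _).const_mul_left (k : ℂ)).neg_left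
    exact (hr.comp_tendsto h_tendsto).trans (h_linear.pow N)

theorem isBigO_mul_sub_partialSum {h : ℂ → ℂ} {c : ℕ → ℂ}
    (hc : ∀ᶠ w in 𝓝 0, HasSum (fun n => c n * w ^ n) (h w)) (j N : ℕ) :
    (fun w => w ^ j * h w - ∑ n ∈ Finset.range N, c n * w ^ (j + n)) =O[𝓝 0]
      fun w => w ^ N := by
  have h_taylor : (fun w => h w - ∑ n ∈ Finset.range N, c n * w ^ n) =O[𝓝 0] fun w => w ^ N := by
    have h_norm := (hasFPowerSeriesAt_ofScalars_iff.2 hc).isBigO_sub_partialSum_pow N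
    refine (h_norm.congr_left fun w => ?_).trans (isBigO_of_le _ fun w => by simp)
    simp [FormalMultilinearSeries.partialSum, mul_comm]
  have h_bounded : (fun w : ℂ => w ^ j) =O[𝓝 0] fun _ => (1 : ℂ) :=
    ((continuous_pow j).tendsto 0).isBigO_one ℂ
  refine (h_bounded.mul h_taylor).congr (fun w => ?_) fun w => one_mul _
  simp only [mul_sub, Finset.mul_sum, pow_add, mul_left_comm]

theorem tendsto_symbolEval {a : 𝓜[X]} {p : ℂ[X]}
    (ha : Tendsto (fun z => expansion z a) (𝓝[≠] 0) (𝓝 (p : ℂ⟦X⟧))) {h : ℂ → ℂ} {c : ℕ → ℂ}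
    (hc : ∀ᶠ w in 𝓝 0, HasSum (fun n => c n * w ^ n) (h w)) (j : ℕ) :
    Tendsto (fun z => symbolEval a z fun w => w ^ j * h w) (𝓝[≠] 0)
      (𝓝 (j.factorial * (differentialOp c p).coeff j)) := by
  obtain ⟨N, hN, hp⟩ :=
    ((eventually_tendsto_symbolEval_zero a).and (eventually_gt_atTop p.natDegree)).exists
  have h_partial : Tendsto (fun z => ∑ n ∈ Finset.range N,
      c n * ((j + n).factorial * PowerSeries.coeff (j + n) (expansion z a))) (𝓝[≠] 0)
      (𝓝 (∑ n ∈ Finset.range N, c n * ((j + n).factorial * p.coeff (j + n)))) := by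
    refine tendsto_finsetSum _ fun n _ => Tendsto.const_mul _ (Tendsto.const_mul _ ?_)
    simpa using (PowerSeries.WithPiTopology.tendsto_iff_coeff_tendsto ℂ _ _ _).1 ha (j + n)
  have h_limit : ∑ n ∈ Finset.range N, c n * ((j + n).factorial * p.coeff (j + n)) =
      j.factorial * (differentialOp c p).coeff j := by
    rw [coeff_differentialOp c hp, Finset.mul_sum]
    refine Finset.sum_congr rfl fun n _ => ?_
    rw [← Nat.factorial_mul_descFactorial (Nat.le_add_left n j), Nat.add_sub_cancel]
    push_cast
    ring
  have h_split (z : ℂ) : symbolEval a z (fun w => w ^ j * h w) =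
      symbolEval a z (fun w => w ^ j * h w - ∑ n ∈ Finset.range N, c n * w ^ (j + n)) +
        ∑ n ∈ Finset.range N,
          c n * ((j + n).factorial * PowerSeries.coeff (j + n) (expansion z a)) := by
    simp only [← symbolEval_pow, ← smul_eq_mul (c _), ← map_smul, ← map_sum, ← map_add]
    congr 1
    ext w
    simp
  rw [← h_limit, ← zero_add (∑ n ∈ Finset.range N, _)]
  simp only [h_split]
  exact (hN _ (isBigO_mul_sub_partialSum hc j N)).add h_partial

theorem tendsto_expansion_X :
    Tendsto (fun z => expansion z X) (𝓝[≠] 0) (𝓝 1) := by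
  refine (PowerSeries.WithPiTopology.tendsto_iff_coeff_tendsto ℂ _ _ _).2 fun j => ?_
  simp only [expansion_X, PowerSeries.coeff_rescale]
  refine (Continuous.tendsto' (by fun_prop) 0 _ ?_).mono_left nhdsWithin_le_nhds
  rcases eq_or_ne j 0 with rfl | hj
  · simp
  · simp [hj, PowerSeries.coeff_one]

theorem tendsto_expansion_C {b : 𝓜} {v : ℂ} (hb : Tendsto b.1 (𝓝[≠] 0) (𝓝 v)) :
    Tendsto (fun z => expansion z (C b)) (𝓝[≠] 0) (𝓝 (PowerSeries.C v)) := by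
  simp only [expansion_C]
  refine (PowerSeries.WithPiTopology.tendsto_iff_coeff_tendsto ℂ _ _ _).2 fun j => ?_
  rcases eq_or_ne j 0 with rfl | hj
  · simpa using hb
  · simp [PowerSeries.coeff_C, hj]

theorem tendsto_eval_of_tendsto_expansion {K : Type*} [Field K] [Algebra K ℂ] {a : 𝓜[X]}
    {p : ℂ[X]} (ha : Tendsto (fun z => expansion z a) (𝓝[≠] 0) (𝓝 (p : ℂ⟦X⟧))) {μ s : ℝ}
    (hsμ : 0 < s / μ) :
    Tendsto (fun z => scaleEval K μ a z s) (𝓝[≠] 0) (𝓝 (p.eval (Real.log (s / μ) : ℂ))) := by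
  set l : ℂ := (Real.log (s / μ) : ℂ)
  have h_exp (w : ℂ) :
      HasSum (fun n => l ^ n / n.factorial * w ^ n) (Complex.exp (l * w)) := by
    have h := NormedSpace.expSeries_div_hasSum_exp (l * w)
    rw [← Complex.exp_eq_exp_ℂ] at h
    exact h.congr_fun fun n => by rw [mul_pow, div_mul_eq_mul_div]
  have h_eval : ((0).factorial : ℂ) * (differentialOp (fun n => l ^ n / n.factorial) p).coeff 0 =
      p.eval l := by
    rw [coeff_differentialOp _ p.natDegree.lt_succ_self, eval_eq_sum_range, Nat.factorial_zero,
      Nat.cast_one, one_mul]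
    refine Finset.sum_congr rfl fun n _ => ?_
    rw [zero_add, Nat.descFactorial_self]
    field_simp [Nat.cast_ne_zero.2 n.factorial_ne_zero]
  have h_tendsto := tendsto_symbolEval ha (.of_forall h_exp) 0
  rw [h_eval] at h_tendsto
  simpa only [scaleEval_eq_symbolEval K hsμ, pow_zero, one_mul] using h_tendsto

end Limits

section PhysicalLimit

open Filter Polynomial MeasureTheory
open scoped PowerSeries PowerSeries.WithPiTopology

section Subtraction

variable (K : Type*) [Field K] [Algebra K ℂ]

theorem coeff_zero_expansion_sub_evalOne (z : ℂ) (a : 𝓜[X]) :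
    PowerSeries.coeff 0 (expansion z (a - evalOne K a)) = 0 := by
  rw [map_sub, map_sub, evalOne_apply, expansion_C, PowerSeries.coeff_zero_C,
    coeff_zero_expansion, sub_self]

theorem coeff_succ_expansion_sub_evalOne (z : ℂ) (a : 𝓜[X]) (j : ℕ) :
    PowerSeries.coeff (j + 1) (expansion z (a - evalOne K a)) =
      PowerSeries.coeff (j + 1) (expansion z a) := by
  rw [map_sub, map_sub, evalOne_apply, expansion_C, PowerSeries.coeff_succ_C, sub_zero]

/- The simple pole of `F = H / w` cancels against the factor `w` that comes with every coefficient
other than the constant one, which is the only one removed by the subtraction. -/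
theorem coeff_succ_expansion_feynmanOp {F : 𝓜} {H : ℂ → ℂ} (hF : ∀ z, F.1 z = H z / z) (u : 𝓜)
    (a : 𝓜[X]) {z : ℂ} (hz : z ≠ 0) (j : ℕ) :
    PowerSeries.coeff (j + 1) (expansion z (feynmanOp F u a)) =
      -((j + 1).factorial : ℂ)⁻¹ * symbolEval (C u * X * a) z fun w => w ^ j * H (-w) := by
  have h_coeff : (C u * X * a).coeff 0 = 0 := by simp
  rw [coeff_expansion, feynmanOp_apply, symbolEval_multiplier, ← smul_eq_mul (-_), ← map_smul]
  refine symbolEval_congr h_coeff hz fun w hw => ?_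
  rw [hF, Pi.smul_apply, smul_eq_mul, pow_succ]
  field_simp

variable {K}

theorem tendsto_expansion_sub_evalOne {F u : 𝓜} {H : ℂ → ℂ} {c : ℕ → ℂ}
    (hF : ∀ z, F.1 z = H z / z) (hH : ∀ᶠ w in 𝓝 0, HasSum (fun n => c n * w ^ n) (H w))
    (hu : Tendsto u.1 (𝓝[≠] 0) (𝓝 1)) {a : 𝓜[X]} {p : ℂ[X]}
    (ha : Tendsto (fun z => expansion z a) (𝓝[≠] 0) (𝓝 (p : ℂ⟦X⟧))) :
    Tendsto (fun z => expansion z (feynmanOp F u a - evalOne K (feynmanOp F u a))) (𝓝[≠] 0)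
      (𝓝 (physicalOp c p : ℂ⟦X⟧)) := by
  have h_mul : Tendsto (fun z => expansion z (C u * X * a)) (𝓝[≠] 0) (𝓝 (p : ℂ⟦X⟧)) := by
    simpa using ((tendsto_expansion_C hu).mul tendsto_expansion_X).mul ha
  have h_neg : ∀ᶠ w in 𝓝 0, HasSum (fun n => (-1) ^ n * c n * w ^ n) (H (-w)) := by
    filter_upwards [(continuous_neg.tendsto' (0 : ℂ) 0 neg_zero).eventually hH] with w hw
    exact hw.congr_fun fun n => by rw [neg_pow]; ring
  refine (PowerSeries.WithPiTopology.tendsto_iff_coeff_tendsto ℂ _ _ _).2 fun j => ?_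
  rw [coeff_coe]
  rcases j with _ | j
  · simp only [coeff_zero_expansion_sub_evalOne, coeff_zero_physicalOp, tendsto_const_nhds_iff]
  · simp only [coeff_succ_expansion_sub_evalOne]
    have h_limit : (physicalOp c p).coeff (j + 1) = -((j + 1).factorial : ℂ)⁻¹ *
        (j.factorial * (differentialOp (fun n => (-1) ^ n * c n) p).coeff j) := by
      rw [coeff_succ_physicalOp, Nat.factorial_succ]
      push_cast
      field_simp [Nat.cast_ne_zero.2 j.factorial_ne_zero]
    rw [h_limit]
    refine ((tendsto_symbolEval h_mul h_neg j).const_mul _).congr' ?_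
    filter_upwards [self_mem_nhdsWithin] with z hz
    exact (coeff_succ_expansion_feynmanOp hF u a hz j).symm

theorem renormalize_feynmanOp_bPlus (F u : 𝓜) (x : HR K) :
    renormalize (evalOne K) (universalHom K (feynmanOp F u)) (bPlus K x) =
      feynmanOp F u (renormalize (evalOne K) (universalHom K (feynmanOp F u)) x) -
        evalOne K (feynmanOp F u (renormalize (evalOne K) (universalHom K (feynmanOp F u)) x)) :=
  renormalize_bPlus (L := (feynmanOp F u).restrictScalars K) (evalOne_evalOne K)
    (universalHom_bPlus K ((feynmanOp F u).restrictScalars K)) (feynmanOp_evalOne_mul K F u) x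

theorem tendsto_expansion_renormalize {F u : 𝓜} {H : ℂ → ℂ} {c : ℕ → ℂ}
    (hF : ∀ z, F.1 z = H z / z) (hH : ∀ᶠ w in 𝓝 0, HasSum (fun n => c n * w ^ n) (H w))
    (hu : Tendsto u.1 (𝓝[≠] 0) (𝓝 1)) (x : HR K) :
    Tendsto (fun z => expansion z
        (renormalize (evalOne K) (universalHom K (feynmanOp F u)) x)) (𝓝[≠] 0)
      (𝓝 (universalHom K (physicalOp c) x : ℂ⟦X⟧)) := by
  induction x using HR_induction with
  | scalar r =>
    rw [AlgHom.commutes, AlgHom.commutes]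
    have h_const (z : ℂ) : expansion z (algebraMap K 𝓜[X] r) =
        (algebraMap K ℂ[X] r : ℂ⟦X⟧) := (expansion_C z _).trans (coe_C _).symm
    simp only [h_const, tendsto_const_nhds]
  | add x y hx hy => simpa only [map_add, coe_add] using hx.add hy
  | mul x y hx hy => simpa only [map_mul, coe_mul] using hx.mul hy
  | bPlus s ih =>
    rw [renormalize_feynmanOp_bPlus, universalHom_bPlus_forest]
    exact tendsto_expansion_sub_evalOne hF hH hu ih

end Subtraction

section Kernel

variable {K : Type*} [Field K] [Algebra K ℂ]

theorem tendsto_scaleFactor (μ : ℝ) : Tendsto (scaleFactor μ).1 (𝓝[≠] 0) (𝓝 1) :=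
  (Continuous.tendsto' (show Continuous fun z => Complex.exp (-z * Real.log μ) by fun_prop) 0 1
    (by simp)).mono_left
    nhdsWithin_le_nhds

theorem exists_mellin_eq_div {f : ℝ → ℂ} {c : ℕ → ℂ}
    (hc : ∀ᶠ z in nhdsHalfPlane, HasSum (fun n : ℕ => c n * z ^ ((n : ℤ) - 1))
      (∫ ζ in Set.Ioi (0 : ℝ), f ζ * (ζ : ℂ) ^ (-z))) :
    ∃ (F : 𝓜) (H : ℂ → ℂ), (∀ z, F.1 z = H z / z) ∧
      (∀ᶠ w in 𝓝 0, HasSum (fun n => c n * w ^ n) (H w)) ∧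
      ∀ᶠ z in nhdsHalfPlane, ∫ ζ in Set.Ioi (0 : ℝ), f ζ * (ζ : ℂ) ^ (-z) = F.1 z := by
  obtain ⟨H, hH, hF⟩ := exists_hasSum_of_hasSum_laurent hc
  have h_meromorphic : MeromorphicAt (fun z => H z / z) 0 :=
    (hasFPowerSeriesAt_ofScalars_iff.2 hH).analyticAt.meromorphicAt.div analyticAt_id.meromorphicAt
  exact ⟨⟨_, h_meromorphic⟩, H, fun _ => rfl, hH, hF⟩

theorem isPhysicalLimit_universalHom {f : ℝ → ℂ} {c : ℕ → K}
    (hf : ∀ᶠ z in nhdsHalfPlane, IntegrableOn (fun ζ : ℝ => f ζ * (ζ : ℂ) ^ (-z)) (Set.Ioi 0))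
    (hc : ∀ᶠ z in nhdsHalfPlane, HasSum (fun n : ℕ => algebraMap K ℂ (c n) * z ^ ((n : ℤ) - 1))
      (∫ ζ in Set.Ioi (0 : ℝ), f ζ * (ζ : ℂ) ^ (-z))) {μ : ℝ} (hμ : 0 < μ) :
    IsPhysicalLimit K f μ (universalHom K (physicalOp c)) := by
  obtain ⟨F, H, hFH, hH, hF⟩ := exists_mellin_eq_div hc
  intro x s hs
  set a := renormalize (evalOne K) (universalHom K (feynmanOp F (scaleFactor μ))) x
  have h_germ := (germ_eq_germ_iff K).1
    (DFunLike.congr_fun (germ_comp_toyRenormalized hf hF hμ) x)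
  refine ⟨fun z => scaleEval K μ a z s, ?_, ?_, ?_⟩
  · simpa only [scaleEval_eq_symbolEval K (div_pos hs hμ)] using meromorphicAt_symbolEval_exp a _
  · filter_upwards [h_germ] with z hz
    exact hz s hs
  · have h_expansion := tendsto_expansion_renormalize hFH hH (tendsto_scaleFactor μ) x
    have h_value := tendsto_eval_of_tendsto_expansion (K := K) h_expansion (div_pos hs hμ)
    have h_map := map_universalHom_physicalOp (L := ℂ) c x
    rwa [← eval_map_algebraMap, h_map]

end Kernel

section Uniqueness

theorem HasPhysicalLimit.unique {g : ℂ → ℂ} {v w : ℂ} (hv : HasPhysicalLimit g v)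
    (hw : HasPhysicalLimit g w) : v = w := by
  obtain ⟨G, -, hG, hGv⟩ := hv
  obtain ⟨G', -, hG', hGw⟩ := hw
  refine tendsto_nhds_unique_of_eventuallyEq (hGv.mono_left halfPlane_le_punctured)
    (hGw.mono_left halfPlane_le_punctured) ?_
  filter_upwards [hG, hG'] with z hz hz'
  exact hz.symm.trans hz'

variable {K : Type*} [Field K] [Algebra K ℂ]

theorem eq_of_aeval_ofReal_eq {p q : K[X]} (h : ∀ x : ℝ, aeval (x : ℂ) p = aeval (x : ℂ) q) :
    p = q := by
  refine map_injective (algebraMap K ℂ) (algebraMap K ℂ).injective ?_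
  refine eq_of_infinite_eval_eq _ _
    ((Set.infinite_range_of_injective Complex.ofReal_injective).mono ?_)
  rintro _ ⟨x, rfl⟩
  simpa only [Set.mem_ofPred_eq, eval_map_algebraMap] using h x

theorem IsPhysicalLimit.unique {f : ℝ → ℂ} {μ : ℝ} (hμ : 0 < μ) {Φ Ψ : HR K → K[X]}
    (hΦ : IsPhysicalLimit K f μ Φ) (hΨ : IsPhysicalLimit K f μ Ψ) : Φ = Ψ := by
  refine funext fun x => eq_of_aeval_ofReal_eq fun l => ?_
  have h_scale : Real.log (μ * Real.exp l / μ) = l := by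
    rw [mul_div_cancel_left₀ _ hμ.ne', Real.log_exp]
  have hs : 0 < μ * Real.exp l := mul_pos hμ l.exp_pos
  simpa only [h_scale] using (hΦ x _ hs).unique (hΨ x _ hs)

end Uniqueness

end PhysicalLimit

section OriginalKernel

open MeasureTheory Set

theorem setIntegral_Ioi_one_eq_setIntegral_inv {E : Type*} [NormedAddCommGroup E] [NormedSpace ℝ E]
    (g : ℝ → E) : ∫ x in Ioi (1 : ℝ), g x = ∫ t in Ioc (0 : ℝ) 1, (t ^ 2)⁻¹ • g t⁻¹ := by
  have h_image : (fun t : ℝ => t⁻¹) '' Ioo 0 1 = Ioi 1 := by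
    rw [image_inv_eq_inv, inv_Ioo_0_left one_pos, inv_one]
  rw [← h_image, integral_image_eq_integral_abs_deriv_smul measurableSet_Ioo
    (fun t ht => (hasDerivAt_inv ht.1.ne').hasDerivWithinAt) inv_injective.injOn,
    integral_Ioc_eq_integral_Ioo]
  simp only [abs_neg, abs_inv, abs_sq]

section Moments

variable {g : ℝ → ℂ} {C : ℝ}

theorem integrableOn_cpow_mul (hg : AEStronglyMeasurable g (volume.restrict (Ioc 0 1)))
    (hC : ∀ t ∈ Ioc 0 1, ‖g t‖ ≤ C) {w : ℂ} (hw : -1 < w.re) :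
    IntegrableOn (fun t : ℝ => (t : ℂ) ^ w * g t) (Ioc 0 1) :=
  ((intervalIntegrable_iff_integrableOn_Ioc_of_le zero_le_one).1
    (intervalIntegral.intervalIntegrable_cpow' hw)).mul_bdd hg
    ((ae_restrict_mem measurableSet_Ioc).mono hC)

theorem hasSum_cpow_of_pos {t : ℝ} (ht : 0 < t) (w : ℂ) :
    HasSum (fun n : ℕ => w ^ n / n.factorial * (Real.log t : ℂ) ^ n) ((t : ℂ) ^ w) := by
  have h_exp := NormedSpace.expSeries_div_hasSum_exp ((Real.log t : ℂ) * w)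
  rw [← Complex.exp_eq_exp_ℂ, Complex.ofReal_log ht.le,
    ← Complex.cpow_def_of_ne_zero (Complex.ofReal_ne_zero.2 ht.ne'), ← Complex.ofReal_log ht.le]
    at h_exp
  exact h_exp.congr_fun fun n => by ring

theorem hasSum_rpow_neg_of_mem_Ioc {t : ℝ} (ht : t ∈ Ioc 0 1) (r : ℝ) :
    HasSum (fun n : ℕ => r ^ n / n.factorial * |Real.log t| ^ n) (t ^ (-r)) := by
  have h_exp := NormedSpace.expSeries_div_hasSum_exp (Real.log t * -r)
  rw [← Real.exp_eq_exp_ℝ, ← Real.rpow_def_of_pos ht.1] at h_exp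
  refine h_exp.congr_fun fun n => ?_
  rw [abs_of_nonpos (Real.log_nonpos ht.1.le ht.2)]
  ring

theorem hasSum_integral_cpow_mul (hg : AEStronglyMeasurable g (volume.restrict (Ioc 0 1)))
    (hC : ∀ t ∈ Ioc 0 1, ‖g t‖ ≤ C) {w : ℂ} (hw : ‖w‖ < 1) :
    HasSum (fun n : ℕ => w ^ n / n.factorial * ∫ t in Ioc (0 : ℝ) 1, (Real.log t : ℂ) ^ n * g t)
      (∫ t in Ioc (0 : ℝ) 1, (t : ℂ) ^ w * g t) := by
  have h_bound {t : ℝ} (ht : t ∈ Ioc 0 1) :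
      HasSum (fun n : ℕ => ‖w‖ ^ n / n.factorial * |Real.log t| ^ n * C) (t ^ (-‖w‖) * C) :=
    (hasSum_rpow_neg_of_mem_Ioc ht ‖w‖).mul_right C
  have h_integrable : IntegrableOn (fun t : ℝ => t ^ (-‖w‖) * C) (Ioc 0 1) :=
    ((intervalIntegrable_iff_integrableOn_Ioc_of_le zero_le_one).1
      (intervalIntegral.intervalIntegrable_rpow' (by linarith))).mul_const C
  simp only [← integral_const_mul, ← mul_assoc]
  refine hasSum_integral_of_dominated_convergence
    (fun n t => ‖w‖ ^ n / n.factorial * |Real.log t| ^ n * C) (fun n => ?_) (fun n => ?_) ?_ ?_ ?_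
  · exact AEStronglyMeasurable.mul (Measurable.aestronglyMeasurable (by fun_prop)) hg
  · filter_upwards [ae_restrict_mem measurableSet_Ioc] with t ht
    rw [norm_mul, norm_mul, norm_div, norm_pow, norm_pow, Complex.norm_natCast, Complex.norm_real,
      Real.norm_eq_abs]
    exact mul_le_mul_of_nonneg_left (hC t ht) (by positivity)
  · filter_upwards [ae_restrict_mem measurableSet_Ioc] with t ht
    exact (h_bound ht).summable
  · exact h_integrable.congr_fun (fun t ht => (h_bound ht).tsum_eq.symm) measurableSet_Ioc
  · filter_upwards [ae_restrict_mem measurableSet_Ioc] with t ht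
    exact (hasSum_cpow_of_pos ht.1 w).mul_right (g t)

end Moments

theorem ofReal_add_one_ne_zero {t : ℝ} (ht : 0 ≤ t) : (t : ℂ) + 1 ≠ 0 := by
  exact_mod_cast (add_pos_of_nonneg_of_pos ht one_pos).ne'

theorem norm_one_div_ofReal_add_one {t : ℝ} (ht : 0 ≤ t) : ‖1 / ((t : ℂ) + 1)‖ = 1 / (t + 1) := by
  rw [norm_div, norm_one, ← Complex.ofReal_one, ← Complex.ofReal_add, Complex.norm_real,
    Real.norm_of_nonneg (by positivity)]

theorem norm_one_div_ofReal_add_one_le_one {t : ℝ} (ht : 0 ≤ t) : ‖1 / ((t : ℂ) + 1)‖ ≤ 1 := by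
  rw [norm_one_div_ofReal_add_one ht]
  exact div_le_one_of_le₀ (by linarith) (by positivity)

theorem aestronglyMeasurable_one_div_add_one (μ : Measure ℝ) :
    AEStronglyMeasurable (fun t : ℝ => 1 / ((t : ℂ) + 1)) μ :=
  Measurable.aestronglyMeasurable (by fun_prop)

theorem integrableOn_one_div_add_one_mul_cpow {z : ℂ} (h0 : 0 < z.re) (h1 : z.re < 1) :
    IntegrableOn (fun ζ : ℝ => 1 / ((ζ : ℂ) + 1) * (ζ : ℂ) ^ (-z)) (Ioi 0) := by
  have h_mellin : MellinConvergent (fun ζ : ℝ => 1 / ((ζ : ℂ) + 1)) (1 - z) := by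
    refine mellinConvergent_of_isBigO_rpow (a := 1) (b := 0) ?_ (.of_bound 1 ?_) (by simpa using h0)
      (.of_bound 1 ?_) (by simpa using h1)
    · refine ContinuousOn.locallyIntegrableOn (fun ζ hζ => ContinuousAt.continuousWithinAt ?_)
        measurableSet_Ioi
      have := ofReal_add_one_ne_zero (mem_Ioi.1 hζ).le
      fun_prop (disch := assumption)
    · filter_upwards [Filter.eventually_gt_atTop 0] with ζ hζ
      rw [norm_one_div_ofReal_add_one hζ.le, one_mul, Real.rpow_neg_one, norm_inv,
        Real.norm_of_nonneg hζ.le, one_div]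
      exact inv_anti₀ hζ (by linarith)
    · filter_upwards [self_mem_nhdsWithin] with ζ hζ
      rw [neg_zero, Real.rpow_zero, norm_one, one_mul]
      exact norm_one_div_ofReal_add_one_le_one (mem_Ioi.1 hζ).le
  refine IntegrableOn.congr_fun h_mellin (fun ζ _ => ?_) measurableSet_Ioi
  simp only [smul_eq_mul]
  rw [sub_sub_cancel_left, mul_comm]

theorem setIntegral_Ioi_one_one_div_add_one_mul_cpow {z : ℂ} (h0 : 0 < z.re) :
    ∫ ζ in Ioi (1 : ℝ), 1 / ((ζ : ℂ) + 1) * (ζ : ℂ) ^ (-z) =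
      1 / z - ∫ t in Ioc (0 : ℝ) 1, (t : ℂ) ^ z * (1 / ((t : ℂ) + 1)) := by
  have hz : z ≠ 0 := fun h => h0.ne' (h ▸ Complex.zero_re)
  have h_re : -1 < (z - 1).re := by simpa using h0
  have h_pole : ∫ t in Ioc (0 : ℝ) 1, (t : ℂ) ^ (z - 1) = 1 / z := by
    rw [← intervalIntegral.integral_of_le zero_le_one, integral_cpow (.inl h_re)]
    simp [hz]
  rw [← h_pole, ← integral_sub ((intervalIntegrable_iff_integrableOn_Ioc_of_le zero_le_one).1
      (intervalIntegral.intervalIntegrable_cpow' h_re))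
    (integrableOn_cpow_mul (aestronglyMeasurable_one_div_add_one _)
      (fun t ht => norm_one_div_ofReal_add_one_le_one ht.1.le) (by linarith)),
    setIntegral_Ioi_one_eq_setIntegral_inv]
  refine setIntegral_congr_fun measurableSet_Ioc fun t ht => ?_
  have ht_ne : (t : ℂ) ≠ 0 := Complex.ofReal_ne_zero.2 ht.1.ne'
  have h_fractions : ((t : ℂ) ^ 2)⁻¹ * (1 / ((t : ℂ)⁻¹ + 1)) = (t : ℂ)⁻¹ - 1 / ((t : ℂ) + 1) := by
    have h_add := ofReal_add_one_ne_zero ht.1.le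
    have h_add_comm : 1 + (t : ℂ) ≠ 0 := add_comm (t : ℂ) 1 ▸ h_add
    field_simp
    ring
  have h_arg : (t : ℂ).arg ≠ Real.pi := by
    rw [Complex.arg_ofReal_of_nonneg ht.1.le]
    exact Real.pi_pos.ne
  have h_inv : ((t⁻¹ : ℝ) : ℂ) ^ (-z) = (t : ℂ) ^ z := by
    rw [Complex.ofReal_inv, Complex.inv_cpow _ _ h_arg, Complex.cpow_neg, inv_inv]
  rw [h_inv, Complex.cpow_sub _ _ ht_ne, Complex.cpow_one, Complex.real_smul]
  push_cast
  linear_combination (t : ℂ) ^ z * h_fractions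

theorem integral_one_div_add_one_mul_cpow {z : ℂ} (h0 : 0 < z.re) (h1 : z.re < 1) :
    ∫ ζ in Ioi (0 : ℝ), 1 / ((ζ : ℂ) + 1) * (ζ : ℂ) ^ (-z) =
      1 / z + ((∫ t in Ioc (0 : ℝ) 1, (t : ℂ) ^ (-z) * (1 / ((t : ℂ) + 1))) -
        ∫ t in Ioc (0 : ℝ) 1, (t : ℂ) ^ z * (1 / ((t : ℂ) + 1))) := by
  have h_integrable := integrableOn_one_div_add_one_mul_cpow h0 h1
  rw [← Ioc_union_Ioi_eq_Ioi (zero_le_one' ℝ),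
    setIntegral_union Ioc_disjoint_Ioi_same measurableSet_Ioi
      (h_integrable.mono_set Ioc_subset_Ioi_self)
      (h_integrable.mono_set (Ioi_subset_Ioi zero_le_one)),
    setIntegral_Ioi_one_one_div_add_one_mul_cpow h0]
  simp only [mul_comm (1 / _ : ℂ)]
  ring

theorem hasSum_laurent_of_hasSum {c : ℕ → ℂ} {z v : ℂ} (h : HasSum (fun n => c (n + 1) * z ^ n) v) :
    HasSum (fun n : ℕ => c n * z ^ ((n : ℤ) - 1)) (c 0 / z + v) := by
  have h_shift : HasSum (fun n : ℕ => c (n + 1) * z ^ (((n + 1 : ℕ) : ℤ) - 1)) v := by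
    simpa only [Nat.cast_succ, add_sub_cancel_right, zpow_natCast] using h
  simpa [add_comm, div_eq_mul_inv] using
    (hasSum_nat_add_iff (f := fun n : ℕ => c n * z ^ ((n : ℤ) - 1)) 1).1 h_shift

/-- The coefficient of `z ^ (n - 1)` in the Laurent series of the Mellin transform of the kernel
`ζ ↦ 1 / (ζ + 1)`. -/
def originalKernelCoeff : ℕ → ℝ
  | 0 => 1
  | n + 1 => ((-1) ^ n - 1) / n.factorial * ∫ t in Ioc (0 : ℝ) 1, Real.log t ^ n * (1 / (t + 1))

theorem hasSum_originalKernelCoeff {z : ℂ} (h0 : 0 < z.re) (h1 : ‖z‖ < 1) :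
    HasSum (fun n : ℕ => (originalKernelCoeff n : ℂ) * z ^ ((n : ℤ) - 1))
      (∫ ζ in Ioi (0 : ℝ), 1 / ((ζ : ℂ) + 1) * (ζ : ℂ) ^ (-z)) := by
  have h_moment (n : ℕ) : ∫ t in Ioc (0 : ℝ) 1, (Real.log t : ℂ) ^ n * (1 / ((t : ℂ) + 1)) =
      (∫ t in Ioc (0 : ℝ) 1, Real.log t ^ n * (1 / (t + 1)) : ℝ) := by
    rw [← integral_complex_ofReal]
    push_cast
    rfl
  have h_series {w : ℂ} (hw : ‖w‖ < 1) := hasSum_integral_cpow_mul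
    (aestronglyMeasurable_one_div_add_one _)
    (fun t ht => norm_one_div_ofReal_add_one_le_one ht.1.le) hw
  rw [integral_one_div_add_one_mul_cpow h0 ((Complex.re_le_norm z).trans_lt h1),
    show (1 : ℂ) / z = (originalKernelCoeff 0 : ℂ) / z by simp [originalKernelCoeff]]
  refine hasSum_laurent_of_hasSum (c := fun n => (originalKernelCoeff n : ℂ))
    (((h_series (norm_neg z ▸ h1)).sub (h_series h1)).congr_fun fun n => ?_)
  rw [h_moment, originalKernelCoeff, neg_pow]
  push_cast
  ring

theorem isToyKernel_one_div_add_one : IsToyKernel ℝ (fun ζ : ℝ => 1 / ((ζ : ℂ) + 1)) := by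
  refine ⟨?_, originalKernelCoeff, ?_⟩
  · filter_upwards [Ioo_mem_nhdsGT (zero_lt_one' ℝ)] with σ hσ
    exact integrableOn_one_div_add_one_mul_cpow (by simpa using hσ.1) (by simpa using hσ.2)
  · have h_norm : ∀ᶠ z : ℂ in 𝓝 0, ‖z‖ < 1 :=
      continuous_norm.continuousAt.eventually_lt_const (by simp)
    filter_upwards [self_mem_nhdsWithin, nhdsWithin_le_nhds h_norm] with z h0 h1
    exact hasSum_originalKernelCoeff h0 h1

end OriginalKernel

end ToyModel

theorem mainTheorem3 (K : Type*) [Field K] [Algebra K ℂ] :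
    (∀ f : ℝ → ℂ, ToyModel.IsToyKernel K f →
      (∀ x : ToyModel.HR K, ∀ᶠ z : ℂ in 𝓝[{z | 0 < z.re}] 0, ∀ s : ℝ, 0 < s →
        MeasureTheory.IntegrableOn
          (fun ζ : ℝ => f ζ * ((s * ζ : ℝ) : ℂ) ^ (-z) * ToyModel.toyRule K f x z (s * ζ))
          (Set.Ioi 0)) ∧
      ∃ Φ : ToyModel.HR K →ₐc[K] K[X],
        (∀ x, Φ (HopfAlgebra.antipode K x) = HopfAlgebra.antipode K (Φ x)) ∧
        ∀ μ : ℝ, 0 < μ →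
          ToyModel.IsPhysicalLimit K f μ Φ ∧
          ∀ Ψ : ToyModel.HR K → K[X], ToyModel.IsPhysicalLimit K f μ Ψ → Ψ = Φ) ∧
    ToyModel.IsToyKernel ℝ (fun ζ : ℝ => 1 / ((ζ : ℂ) + 1)) := by
  refine ⟨?_, ToyModel.isToyKernel_one_div_add_one⟩
  have : CharZero K := (RingHom.charZero_iff (algebraMap K ℂ).injective).2 inferInstance
  rintro f ⟨hf, c, hc⟩
  have hf' := ToyModel.eventually_integrableOn_kernel hf
  obtain ⟨F, -, -, -, hF⟩ := ToyModel.exists_mellin_eq_div hc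
  refine ⟨ToyModel.eventually_integrableOn_toyRule hf' hF,
    (ToyModel.isHochschildCocycle_physicalOp c).universalBialgHom,
    ToyModel.bialgHom_antipode _, fun μ hμ => ?_⟩
  have h_limit := ToyModel.isPhysicalLimit_universalHom hf' hc hμ
  exact ⟨h_limit, fun Ψ hΨ => hΨ.unique hμ h_limit⟩
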